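/- **Setting.** An instance is a non-empty finite sequence of jobs $J_1,\dots,J_n$ with processing times $p_j>0$ and submission times $0=r_1\le r_2\le\dots\le r_n$. A feasible schedule on $m\ge 1$ parallel identical machines assigns to each job a machine and a start time $\ge r_j$ such that jobs on the same machine do not overlap (no preemption, no restart); its cost is the total completion time $\sum_j C_j$. A deterministic online algorithm with delayed commitment produces a feasible schedule for every instance, such that for every time $t$ all its decisions (start times and machines of the jobs started) up to time $t$ depend only on the jobs submitted up to time $t$. Its competitive ratio is the supremum, over all instances, of its cost divided by the optimal cost. **Key pattern.** For a time $r\ge 0$, machine availabilities $a_1,\dots,a_m\ge r$ and a makespan $C>\min_h a_h$, let $$\mathcal R(r,a,C)=\frac{\sum_{h=1}^m\left(\max\{a_h,C\}^2-a_h^2\right)}{m\left((C^*)^2-r^2\right)},\qquad C^*=r+\frac1m\sum_{h=1}^m\left(\max\{a_h,C\}-a_h\right).$$ This is the limiting ratio, for many identical infinitely small jobs submitted at time $r$, between their total completion time when machine $h$ is available only from time $a_h$ on, and their optimal total completion time when all machines are available from time $r$ on. **Target ratio.** Consider $m$ long jobs with processing time $1$ and submission time $0$, where the $i$-th one starts on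 machine $i$ with delay $t_i$, $0\le t_1\le\dots\le t_m$. When the $i$-th one starts, machine $h$ becomes available at time $a^{(i)}_h=\max\{t_h+1,t_i\}$ for $h\le i$ and $a^{(i)}_h=t_i$ for $h>i$. The target ratio $\mathcal R_m$ is the infimum of all $R$ for which there are delays $0\le t_1\le\dots\le t_m$ with $$1+\frac1m\sum_{i=1}^m t_i\le R\qquad\text{and}\qquad \mathcal R\big(t_i,a^{(i)},C\big)\le R\ \text{ for all } i \text{ and all } C>\min_h a^{(i)}_h .$$ **Theorem.** For every $m\ge1$, every deterministic online algorithm for non-preemptive total completion time minimization with delayed commitment on $m$ parallel identical machines has competitive ratio at least $\mathcal R_m$. Moreover: 1. $|\mathcal R_2-1.54610|\le 5\cdot 10^{-6}$; 2. $\mathcal R_{2m}<\mathcal R_m$ for every $m\ge 1$; 3. $\mathcal R_m$ converges as $m\to\infty$ to a limit $L$ with $|L-1.366|<0.001$, and $L<\mathcal R_m$ for every $m\ge1$; 4. $\mathcal R_2>1.520$, and $\mathcal R_m>1.309$ for every $m\ge1$ (the values $1.520$ for $m=2$ and $1.309$ for $m\to\infty$ being Vestjens' earlier lower bounds). -/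

import Mathlib

open Filter Topology

namespace OnlineScheduling

noncomputable section

/-- A problem instance: a non-empty finite sequence of jobs with positive processing times `p`,
ordered by non-decreasing submission times `r`, the first one being submitted at time `0`. -/
structure Instance where
  n : ℕ
  p : Fin n → ℝ
  r : Fin n → ℝ
  n_pos : 0 < n
  p_pos : ∀ j, 0 < p j
  r_mono : Monotone r
  r_first : r ⟨0, n_pos⟩ = 0

/-- What is known at time `t`: position in the sequence, processing time and submission time of
every job submitted no later than `t` (and nothing about later jobs, not even how many follow). -/
def Instance.revealed (I : Instance) (t : ℝ) : Set (ℕ × ℝ × ℝ) :=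
  {x | ∃ j : Fin I.n, I.r j ≤ t ∧ x = ((j : ℕ), I.p j, I.r j)}

/-- A non-preemptive assignment of start times and machines to the jobs of `I`. -/
structure Schedule (I : Instance) (m : ℕ) where
  start : Fin I.n → ℝ
  machine : Fin I.n → Fin m

namespace Schedule

variable {I : Instance} {m : ℕ}

/-- The completion time of job `j`. -/
def completion (S : Schedule I m) (j : Fin I.n) : ℝ := S.start j + I.p j

/-- No job starts before its submission, and two jobs on one machine do not overlap. -/
def Feasible (S : Schedule I m) : Prop :=
  (∀ j, I.r j ≤ S.start j) ∧
  ∀ i j, i ≠ j → S.machine i = S.machine j →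
    S.completion i ≤ S.start j ∨ S.completion j ≤ S.start i

/-- The total completion time. -/
def cost (S : Schedule I m) : ℝ := ∑ j, S.completion j

end Schedule

/-- The optimal (offline) total completion time of `I` on `m` machines. -/
def Instance.opt (I : Instance) (m : ℕ) : ℝ :=
  sInf {c | ∃ S : Schedule I m, S.Feasible ∧ S.cost = c}

/-- A deterministic online algorithm with delayed commitment on `m` parallel identical machines:
it produces a feasible schedule for every instance, and whatever it has started up to time `t`
depends only on the jobs submitted up to time `t`. -/
structure OnlineAlgorithm (m : ℕ) where
  schedule : (I : Instance) → Schedule I m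
  feasible : ∀ I, (schedule I).Feasible
  causal : ∀ (I J : Instance) (t : ℝ), I.revealed t = J.revealed t →
    ∀ (i : Fin I.n) (j : Fin J.n), (i : ℕ) = (j : ℕ) → (schedule I).start i ≤ t →
      (schedule J).start j = (schedule I).start i ∧
      (schedule J).machine j = (schedule I).machine i

/-- The competitive ratio: the supremum over all instances of the total completion time of the
algorithm over the optimal total completion time (possibly `⊤`). -/
def OnlineAlgorithm.competitiveRatio {m : ℕ} (A : OnlineAlgorithm m) : EReal :=
  ⨆ I : Instance, (((A.schedule I).cost / I.opt m : ℝ) : EReal)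

/-- The ratio of the key pattern, in the limit of infinitely small identical jobs submitted at
time `r`: machine `h` becomes available at time `a h ≥ r`, the restricted schedule fills the
machines without delay up to makespan `C`, and the optimal schedule may use all machines from
time `r` on and has makespan `r + (∑ h, (max (a h) C - a h)) / m`. -/
def keyRatio {m : ℕ} (r : ℝ) (a : Fin m → ℝ) (C : ℝ) : ℝ :=
  (∑ h, ((max (a h) C) ^ 2 - (a h) ^ 2)) /
    ((m : ℝ) * ((r + (∑ h, (max (a h) C - a h)) / (m : ℝ)) ^ 2 - r ^ 2))

/-- Machine availability at the start `t i` of long job `i`, if long job `h`, of processing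
time `1`, starts on machine `h` at time `t h`. Availability before `t i` counts as `t i`. -/
def availability {m : ℕ} (t : Fin m → ℝ) (i h : Fin m) : ℝ :=
  if h ≤ i then max (t h + 1) (t i) else t i

/-- The delays `t` of `m` long jobs respect the ratio `R`: without small jobs, the total
completion time is at most `R` times the optimal value `m`; and if the key pattern is submitted
at the start of some long job `i`, its ratio is at most `R`, whatever the amount of small jobs
(that is, for all makespans `C` with at least one machine available before `C`). -/
def Respects {m : ℕ} (t : Fin m → ℝ) (R : ℝ) : Prop :=
  ((m : ℝ) + ∑ i, t i) / (m : ℝ) ≤ R ∧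
  ∀ (i : Fin m) (C : ℝ), (∃ h, availability t i h < C) →
    keyRatio (t i) (availability t i) C ≤ R

/-- The target ratio: the smallest ratio that can be respected by a sequence of delays
`0 ≤ t 1 ≤ … ≤ t m` of the `m` long jobs. -/
def targetRatio (m : ℕ) : ℝ :=
  sInf {R | ∃ t : Fin m → ℝ, (∀ i, 0 ≤ t i) ∧ Monotone t ∧ Respects t R}

end

end OnlineScheduling

open OnlineScheduling

/-! The constraint that the key pattern, submitted at time `r` with machine availabilities `a`, has
ratio at most `R` for every makespan has an equivalent dual form, `DualBound`: for all `x ≥ R r`,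
`m (x - R r)² ≤ R ∑ₕ (max (x - aₕ) 0)²`. It comes from Lagrangian duality, `x` being the multiplier
of the total processing time of the small jobs. In this form the constraint is visibly monotone in
`a` and stable under delaying everything by the same amount (`DualBound.shift`), and everything
below rests on that.

*Every algorithm* (`OnlineAlgorithm.targetRatio_le_competitiveRatio`). The adversary submits `m`
long jobs, and takes the sorted start times chosen by the algorithm as delays. After the start of
the `i`-th long job it may submit many equal small jobs; in the algorithm's schedule these wait for
the unfinished long jobs, which occupy different machines, while the optimal schedule runs them
first. As their number grows, the ratio of the costs tends to the key ratio, so the delays respect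
the competitive ratio.

*Dependence on `m`.* By compactness the target ratio is attained. Copying each delay `k` times
shows `targetRatio n ≤ targetRatio m + o(1)` as `n → ∞` (`eventually_targetRatio_le`), so the
target ratios converge to their infimum. After doubling, the first copy of the first positive delay
can be reduced, since one long job fewer has started by then; the slack in the total delay can be
traded for a smaller ratio (`exists_lt_dualFeasible`), whence `targetRatio (2 * m) < targetRatio
m`, and the limit lies strictly below all values.

*Two machines.* The lower bound evaluates the dual bound at nearly optimal multipliers, and the
upper bound is an explicit pair of delays.

*The limit.* For large `m` the delays are compared with profiles, functions of the fraction `x` of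
the jobs started, which vanish up to a threshold and are cubic from there on. If all machines with
a started long job become available before the multiplier, then the dual bound depends on the
profile only through its first two moments, and its validity for all multipliers is a discriminant
condition: a polynomial inequality in `x`, checked with Bernstein coefficients (`lower_disc`,
`upper_disc`). For the lower bound this is all that is needed, because dropping the positive part
only weakens the constraint: inductively, no job can start before the time given by a profile of
integral greater than `0.3651`. For the upper bound, the neglected machines cost at most a fixed
multiple of a square (`upper_tail_le`), which the discriminant condition takes into account, and
small multipliers are reduced to larger ones by Minkowski's inequality (`dual_at_of_le`). -/

namespace OnlineScheduling

/-! ### The dual form of the key constraint -/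

/-- The dual form of the constraint that the key pattern at time `r`, with availabilities `a`, has
ratio at most `R` for every makespan. The number `x` plays the role of a Lagrange multiplier for
the total processing time of the small jobs. -/
def DualBound {m : ℕ} (R r : ℝ) (a : Fin m → ℝ) : Prop :=
  ∀ x : ℝ, R * r ≤ x → (m : ℝ) * (x - R * r) ^ 2 ≤ R * ∑ h, (max (x - a h) 0) ^ 2

lemma posPart_sq_mono {x y : ℝ} (h : x ≤ y) : (max x 0) ^ 2 ≤ (max y 0) ^ 2 :=
  pow_le_pow_left₀ (le_max_right _ _) (max_le_max h le_rfl) 2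

lemma DualBound.mono {m : ℕ} {R r : ℝ} {a b : Fin m → ℝ} (hR : 0 ≤ R) (H : DualBound R r a)
    (hab : ∀ h, b h ≤ a h) : DualBound R r b := fun x hx =>
  (H x hx).trans (mul_le_mul_of_nonneg_left
    (Finset.sum_le_sum fun h _ => posPart_sq_mono (by linarith [hab h])) hR)

/-- Delaying everything by the same amount preserves the constraint, since `R ≥ 1`. -/
lemma DualBound.shift {m : ℕ} {R r δ : ℝ} {a : Fin m → ℝ} (hR : 1 ≤ R) (hδ : 0 ≤ δ)
    (H : DualBound R r a) : DualBound R (r + δ) (fun h => a h + δ) := by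
  intro x hx
  have h1 : R * δ ≥ δ := by nlinarith
  have h2 := H (x - δ) (by linarith)
  have h3 : (x - R * (r + δ)) ^ 2 ≤ (x - δ - R * r) ^ 2 :=
    pow_le_pow_left₀ (by linarith) (by linarith) 2
  calc (m : ℝ) * (x - R * (r + δ)) ^ 2 ≤ m * (x - δ - R * r) ^ 2 := by gcongr
    _ ≤ _ := h2
    _ = _ := by
      congr 1
      exact Finset.sum_congr rfl fun h _ => by rw [sub_sub, add_comm δ]

lemma DualBound.mono_ratio {m : ℕ} {R R' r : ℝ} {a : Fin m → ℝ} (hr : 0 ≤ r) (hR : R ≤ R')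
    (H : DualBound R r a) : DualBound R' r a := by
  intro x hx
  have h1 : R * r ≤ R' * r := by gcongr
  have h2 := H x (by linarith)
  have h3 : (x - R' * r) ^ 2 ≤ (x - R * r) ^ 2 :=
    pow_le_pow_left₀ (by linarith) (by linarith) 2
  calc (m : ℝ) * (x - R' * r) ^ 2 ≤ m * (x - R * r) ^ 2 := by gcongr
    _ ≤ _ := h2
    _ ≤ _ := by gcongr

lemma max_sq_sub_sq (a C : ℝ) :
    (max a C) ^ 2 - a ^ 2 = 2 * C * (max a C - a) - (max a C - a) ^ 2 := by
  rcases le_total a C with h | h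
  · rw [max_eq_right h]; ring
  · rw [max_eq_left h]; ring

/-- The tangent inequality of the convex function `x ↦ (max (x - a) 0) ^ 2` at `C`. -/
lemma posPart_sq_tangent (a C x : ℝ) :
    (max a C - a) ^ 2 + 2 * (max a C - a) * (x - C) ≤ (max (x - a) 0) ^ 2 := by
  rcases le_total a C with h | h
  · rw [max_eq_right h]
    rcases le_total (x - a) 0 with h' | h'
    · rw [max_eq_right h']; nlinarith [mul_nonneg (sub_nonneg.2 h) (neg_nonneg.2 h')]
    · rw [max_eq_left h']; nlinarith [sq_nonneg (x - C)]
  · rw [max_eq_left h]; simp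

lemma sum_max_sq_sub_sq {m : ℕ} (a : Fin m → ℝ) (C : ℝ) :
    ∑ h, ((max (a h) C) ^ 2 - (a h) ^ 2) =
      2 * C * ∑ h, (max (a h) C - a h) - ∑ h, (max (a h) C - a h) ^ 2 := by
  rw [Finset.mul_sum, ← Finset.sum_sub_distrib]
  exact Finset.sum_congr rfl fun h _ => max_sq_sub_sq _ _

lemma sum_max_sub_pos {m : ℕ} {a : Fin m → ℝ} {C : ℝ} (hC : ∃ h, a h < C) :
    0 < ∑ h, (max (a h) C - a h) := by
  obtain ⟨h, hh⟩ := hC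
  refine Finset.sum_pos' (fun i _ => sub_nonneg.2 (le_max_left _ _)) ⟨h, Finset.mem_univ _, ?_⟩
  rw [max_eq_right hh.le]; linarith

/-- With `v` the volume of the small jobs, `keyRatio` compares twice the restricted cost with
`2 r v + v ^ 2 / m`. -/
lemma keyRatio_le_iff {m : ℕ} (hm : 0 < m) {R r C : ℝ} {a : Fin m → ℝ} (hr : 0 ≤ r)
    (hC : ∃ h, a h < C) :
    keyRatio r a C ≤ R ↔ ∑ h, ((max (a h) C) ^ 2 - (a h) ^ 2) ≤
      R * (2 * r * ∑ h, (max (a h) C - a h) + (∑ h, (max (a h) C - a h)) ^ 2 / m) := by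
  have hv := sum_max_sub_pos hC
  have hm' : (0 : ℝ) < m := by exact_mod_cast hm
  have e : (m : ℝ) * ((r + (∑ h, (max (a h) C - a h)) / (m : ℝ)) ^ 2 - r ^ 2) =
      2 * r * ∑ h, (max (a h) C - a h) + (∑ h, (max (a h) C - a h)) ^ 2 / m := by
    field_simp; ring
  rw [keyRatio, e, div_le_iff₀ (by positivity)]

/-- For `C ≥ R r` the makespan `C` itself serves as the multiplier; for `C ≤ R r` the small jobs cost
too little to matter. -/
lemma DualBound.keyRatio_le {m : ℕ} (hm : 0 < m) {R r C : ℝ} {a : Fin m → ℝ} (hR : 1 ≤ R)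
    (hr : 0 ≤ r) (H : DualBound R r a) (hC : ∃ h, a h < C) : keyRatio r a C ≤ R := by
  have hv := sum_max_sub_pos hC
  rw [keyRatio_le_iff hm hr hC, sum_max_sq_sub_sq]
  have hm' : (0 : ℝ) < m := by exact_mod_cast hm
  set v := ∑ h, (max (a h) C - a h)
  have hs : 0 ≤ ∑ h, (max (a h) C - a h) ^ 2 := Finset.sum_nonneg fun _ _ => sq_nonneg _
  rcases le_total (R * r) C with h | h
  · have h1 := H C h
    have e : ∑ h, (max (C - a h) 0) ^ 2 = ∑ h, (max (a h) C - a h) ^ 2 :=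
      Finset.sum_congr rfl fun h _ => by
        rw [← max_sub_sub_right, sub_self, max_comm]
    rw [e] at h1
    set s := ∑ h, (max (a h) C - a h) ^ 2
    have h2 : (m : ℝ) * (C - R * r) ^ 2 / R ≤ s := by
      rw [div_le_iff₀ (by linarith)]; linarith
    have h3 : 0 ≤ (m : ℝ) / R * (R * v / m - (C - R * r)) ^ 2 := by positivity
    have h4 : (m : ℝ) / R * (R * v / m - (C - R * r)) ^ 2 =
        R * (2 * r * v + v ^ 2 / m) - 2 * C * v + (m : ℝ) * (C - R * r) ^ 2 / R := by
      field_simp; ring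
    linarith
  · have h1 : 0 ≤ R * (v ^ 2 / m) := by positivity
    nlinarith [mul_le_mul_of_nonneg_right h hv.le]

/-- The converse, where a multiplier `x > R r` is critical for the total processing time
`m (x / R - r)`: the makespan `C` is chosen so that the small jobs have this volume, and the
tangent inequality at `C` gives the bound at `x`. -/
lemma dualBound_of_keyRatio_le {m : ℕ} (hm : 0 < m) {R r : ℝ} {a : Fin m → ℝ} (hR : 1 ≤ R)
    (hr : 0 ≤ r) (ha : ∀ h, r ≤ a h) (H : ∀ C, (∃ h, a h < C) → keyRatio r a C ≤ R) :
    DualBound R r a := by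
  intro x hx
  have hm' : (0 : ℝ) < m := by exact_mod_cast hm
  have hR0 : 0 < R := by linarith
  rcases hx.eq_or_lt with rfl | hx
  · simp; positivity
  -- the volume of small jobs for which the multiplier `x` is critical
  set v := (m : ℝ) * (x / R - r) with hvdef
  have hv : 0 < v := by
    apply mul_pos hm'
    rw [sub_pos, lt_div_iff₀ hR0]; linarith
  obtain ⟨C, hC⟩ : ∃ C, ∑ h, (max (a h) C - a h) = v := by
    have hc : Continuous fun C => ∑ h, (max (a h) C - a h) := by fun_prop
    have h0 : ∑ h, (max (a h) r - a h) = 0 :=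
      Finset.sum_eq_zero fun h _ => by rw [max_eq_left (ha h), sub_self]
    let h0' : Fin m := ⟨0, hm⟩
    have h1 : v ≤ ∑ h, (max (a h) (a h0' + v) - a h) := by
      calc v ≤ max (a h0') (a h0' + v) - a h0' := by
            linarith [le_max_right (a h0') (a h0' + v)]
        _ ≤ _ := Finset.single_le_sum (f := fun h => max (a h) (a h0' + v) - a h)
            (fun h _ => sub_nonneg.2 (le_max_left _ _)) (Finset.mem_univ h0')
    obtain ⟨C, -, hC⟩ := intermediate_value_Icc (by linarith [ha h0'] : r ≤ a h0' + v)
      hc.continuousOn (show v ∈ Set.Icc _ _ from ⟨by simpa only [h0] using hv.le, h1⟩)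
    exact ⟨C, hC⟩
  have hex : ∃ h, a h < C := by
    by_contra! hcon
    rw [Finset.sum_eq_zero fun h _ => by rw [max_eq_left (hcon h), sub_self]] at hC
    exact hv.ne hC
  have h1 := (keyRatio_le_iff hm hr hex).1 (H C hex)
  rw [sum_max_sq_sub_sq, hC] at h1
  have h2 : ∑ h, (max (a h) C - a h) ^ 2 + 2 * v * (x - C) ≤ ∑ h, (max (x - a h) 0) ^ 2 := by
    rw [← hC, Finset.mul_sum, Finset.sum_mul, ← Finset.sum_add_distrib]
    exact Finset.sum_le_sum fun h _ => posPart_sq_tangent _ _ _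
  have h3 : 2 * v * x - R * (2 * r * v + v ^ 2 / m) ≤ ∑ h, (max (x - a h) 0) ^ 2 := by linarith
  have h4 := mul_le_mul_of_nonneg_left h3 hR0.le
  have h5 : R * (2 * v * x - R * (2 * r * v + v ^ 2 / m)) = m * (x - R * r) ^ 2 := by
    rw [hvdef]; field_simp; ring
  linarith

/-- Delays `t` that respect the ratio `R`, in dual form. -/
structure DualFeasible {m : ℕ} (t : Fin m → ℝ) (R : ℝ) : Prop where
  nonneg : ∀ i, 0 ≤ t i
  mono : Monotone t
  sum_le : (m : ℝ) + ∑ i, t i ≤ R * m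
  dual : ∀ i, DualBound R (t i) (availability t i)

lemma le_availability {m : ℕ} (t : Fin m → ℝ) (i h : Fin m) : t i ≤ availability t i h := by
  unfold availability; split_ifs
  · exact le_max_right _ _
  · exact le_rfl

lemma DualFeasible.one_le {m : ℕ} (hm : 0 < m) {t : Fin m → ℝ} {R : ℝ} (H : DualFeasible t R) :
    1 ≤ R := by
  have hm' : (0 : ℝ) < m := by exact_mod_cast hm
  have := Finset.sum_nonneg fun i (_ : i ∈ Finset.univ) => H.nonneg i
  by_contra! hR
  nlinarith [H.sum_le]

lemma dualFeasible_iff {m : ℕ} (hm : 0 < m) (t : Fin m → ℝ) (R : ℝ) :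
    DualFeasible t R ↔ (∀ i, 0 ≤ t i) ∧ Monotone t ∧ Respects t R := by
  have hm' : (0 : ℝ) < m := by exact_mod_cast hm
  constructor
  · intro H
    exact ⟨H.nonneg, H.mono, (div_le_iff₀ hm').2 H.sum_le, fun i C hC =>
      (H.dual i).keyRatio_le hm (H.one_le hm) (H.nonneg i) hC⟩
  · rintro ⟨h0, h1, h2, h3⟩
    have h4 := (div_le_iff₀ hm').1 h2
    have h5 : 1 ≤ R := by
      have := Finset.sum_nonneg fun i (_ : i ∈ Finset.univ) => h0 i
      by_contra! hR
      nlinarith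
    exact ⟨h0, h1, h4, fun i =>
      dualBound_of_keyRatio_le hm h5 (h0 i) (le_availability t i) (h3 i)⟩

lemma targetRatio_eq {m : ℕ} (hm : 0 < m) :
    targetRatio m = sInf {R | ∃ t : Fin m → ℝ, DualFeasible t R} := by
  simp only [targetRatio, dualFeasible_iff hm]

lemma DualFeasible.mono_ratio {m : ℕ} {t : Fin m → ℝ} {R R' : ℝ} (H : DualFeasible t R)
    (hR : R ≤ R') : DualFeasible t R' :=
  ⟨H.nonneg, H.mono, H.sum_le.trans (by gcongr), fun i => (H.dual i).mono_ratio (H.nonneg i) hR⟩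

lemma targetRatio_le {m : ℕ} (hm : 0 < m) {t : Fin m → ℝ} {R : ℝ} (H : DualFeasible t R) :
    targetRatio m ≤ R := by
  rw [targetRatio_eq hm]
  exact csInf_le ⟨1, fun R' ⟨t', h'⟩ => h'.one_le hm⟩ ⟨t, H⟩

/-! ### Attainment of the target ratio, and its dependence on the number of machines -/

lemma dualFeasible_one (m : ℕ) : DualFeasible (fun _ : Fin m => (1 : ℝ)) 2 := by
  refine ⟨fun _ => zero_le_one, fun _ _ _ => le_rfl, by simp; linarith, fun i y hy => ?_⟩
  have h1 : ∑ h : Fin m, (y - 2) ^ 2 ≤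
      ∑ h, (max (y - availability (fun _ : Fin m => (1 : ℝ)) i h) 0) ^ 2 := by
    refine Finset.sum_le_sum fun h _ => pow_le_pow_left₀ (by linarith) ?_ 2
    refine le_trans ?_ (le_max_left _ _)
    unfold availability
    split_ifs <;> norm_num; linarith
  rw [Finset.sum_const, Finset.card_univ, Fintype.card_fin, nsmul_eq_mul] at h1
  have h2 : 0 ≤ (m : ℝ) * (y - 2) ^ 2 := by positivity
  norm_num
  linarith

lemma dualBound_iff {m : ℕ} {R r : ℝ} {a : Fin m → ℝ} (hR : 0 ≤ R) : DualBound R r a ↔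
    ∀ x : ℝ, (m : ℝ) * (max (x - R * r) 0) ^ 2 ≤ R * ∑ h, (max (x - a h) 0) ^ 2 := by
  constructor
  · intro H x
    rcases le_total (R * r) x with h | h
    · rw [max_eq_left (sub_nonneg.2 h)]; exact H x h
    · rw [max_eq_right (sub_nonpos.2 h)]
      have : 0 ≤ R * ∑ h, (max (x - a h) 0) ^ 2 := by positivity
      simpa using this
  · intro H x h
    have := H x
    rwa [max_eq_left (sub_nonneg.2 h)] at this

lemma continuous_availability {m : ℕ} (i h : Fin m) :
    Continuous fun t : Fin m → ℝ => availability t i h := by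
  unfold availability
  split_ifs <;> fun_prop

/-- The infimum in the target ratio is attained. -/
lemma exists_dualFeasible_targetRatio {m : ℕ} (hm : 0 < m) :
    ∃ t : Fin m → ℝ, DualFeasible t (targetRatio m) := by
  have hm' : (0 : ℝ) < m := by exact_mod_cast hm
  set K : Set ((Fin m → ℝ) × ℝ) := {q | DualFeasible q.1 q.2 ∧ q.2 ≤ 2}
  have hKeq : K = {q | (((∀ i, 0 ≤ q.1 i) ∧ ∀ i j, i ≤ j → q.1 i ≤ q.1 j) ∧
      ((m : ℝ) + ∑ i, q.1 i ≤ q.2 * m ∧ 0 ≤ q.2)) ∧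
      ((∀ i : Fin m, ∀ x : ℝ, (m : ℝ) * (max (x - q.2 * q.1 i) 0) ^ 2 ≤
        q.2 * ∑ h, (max (x - availability q.1 i h) 0) ^ 2) ∧ q.2 ≤ 2)} := by
    ext q
    constructor
    · rintro ⟨H, h2⟩
      have h0 : 0 ≤ q.2 := zero_le_one.trans (H.one_le hm)
      exact ⟨⟨⟨H.nonneg, fun i j h => H.mono h⟩, H.sum_le, h0⟩,
        fun i => (dualBound_iff h0).1 (H.dual i), h2⟩
    · rintro ⟨⟨⟨h1, h2⟩, h3, h4⟩, h5, h6⟩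
      exact ⟨⟨h1, fun i j h => h2 i j h, h3, fun i => (dualBound_iff h4).2 (h5 i)⟩, h6⟩
  have hclosed : IsClosed K := by
    rw [hKeq]
    simp only [Set.ofPred_and, Set.ofPred_forall]
    have hav := fun i h : Fin m =>
      (continuous_availability i h).comp (continuous_fst (X := Fin m → ℝ) (Y := ℝ))
    refine ((IsClosed.inter ?_ ?_).inter (IsClosed.inter ?_ ?_)).inter (IsClosed.inter ?_ ?_)
    · exact isClosed_iInter fun i => isClosed_le (by fun_prop) (by fun_prop)
    · exact isClosed_iInter fun i => isClosed_iInter fun j => isClosed_iInter fun _ =>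
        isClosed_le (by fun_prop) (by fun_prop)
    · exact isClosed_le (by fun_prop) (by fun_prop)
    · exact isClosed_le (by fun_prop) (by fun_prop)
    · refine isClosed_iInter fun i => isClosed_iInter fun x => isClosed_le (by fun_prop) ?_
      exact continuous_snd.mul (continuous_finsetSum _ fun h _ =>
        ((continuous_const.sub (hav i h)).max continuous_const).pow 2)
    · exact isClosed_le (by fun_prop) (by fun_prop)
  have hcompact : IsCompact K := by
    refine (isCompact_Icc (a := ((fun _ => 0, 0) : (Fin m → ℝ) × ℝ))
      (b := (fun _ => (m : ℝ), 2))).of_isClosed_subset hclosed ?_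
    rintro ⟨t, R⟩ ⟨H, h2⟩
    have hs := H.sum_le
    simp only at hs h2
    refine ⟨⟨fun i => H.nonneg i, zero_le_one.trans (H.one_le hm)⟩, fun i => ?_, h2⟩
    have h3 := Finset.single_le_sum (fun j _ => H.nonneg j) (Finset.mem_univ i)
    simp only at h3 ⊢
    nlinarith
  obtain ⟨⟨t, R⟩, ⟨hmem, h2⟩, hmin⟩ := hcompact.exists_isMinOn
    ⟨(fun _ => 1, 2), dualFeasible_one m, le_rfl⟩ continuous_snd.continuousOn
  have hR : targetRatio m = R := by
    refine le_antisymm (targetRatio_le hm hmem) ?_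
    rw [targetRatio_eq hm]
    refine le_csInf ⟨R, t, hmem⟩ ?_
    rintro R' ⟨t', H'⟩
    rcases le_total R' 2 with h | h
    · exact hmin (show (t', R') ∈ K from ⟨H', h⟩)
    · exact le_trans h2 h
  exact ⟨t, hR ▸ hmem⟩

lemma availability_add {m : ℕ} (t : Fin m → ℝ) (δ : ℝ) (i h : Fin m) :
    availability (fun j => t j + δ) i h = availability t i h + δ := by
  unfold availability
  split_ifs
  · rw [max_add, add_right_comm]
  · rfl

lemma availability_le {m : ℕ} {t : Fin m → ℝ} {T : ℝ} (hT : ∀ i, t i ≤ T) (i h : Fin m) :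
    availability t i h ≤ T + 1 := by
  unfold availability
  split_ifs
  · exact max_le (by linarith [hT h]) (by linarith [hT i])
  · linarith [hT i]

lemma sq_le_mul_sub_sq {q x b : ℝ} (hq : 1 < q) (hb : 0 ≤ b) (h : 2 * q * b ≤ (q - 1) * x) :
    b ≤ x ∧ x ^ 2 ≤ q * (x - b) ^ 2 := by
  have hbx : b ≤ x := by
    by_contra! hlt
    have := mul_le_mul_of_nonneg_left hlt.le (sub_nonneg.2 hq.le)
    nlinarith
  refine ⟨hbx, ?_⟩
  have h1 := mul_nonneg (hb.trans hbx) (sub_nonneg.2 h)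
  have h2 : 0 ≤ q * b ^ 2 := by positivity
  linarith

/-- If the total delay stays strictly below what the ratio `R` allows, then all delays can be
increased a bit, which makes room for a smaller ratio. -/
lemma exists_lt_dualFeasible {m : ℕ} (hm : 0 < m) {t : Fin m → ℝ} {R : ℝ}
    (H : DualFeasible t R) (hlt : (m : ℝ) + ∑ i, t i < R * m) :
    ∃ R' < R, ∃ t' : Fin m → ℝ, DualFeasible t' R' := by
  have hm' : (0 : ℝ) < m := by exact_mod_cast hm
  have hs0 := Finset.sum_nonneg fun i (_ : i ∈ Finset.univ) => H.nonneg i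
  have hR : 1 < R := by
    by_contra! h
    nlinarith
  set T := ∑ i, t i
  have hT : ∀ i, t i ≤ T := fun i =>
    Finset.single_le_sum (fun j _ => H.nonneg j) (Finset.mem_univ i)
  -- half of the slack is spent on the delays, the other half on the ratio
  set δ := (R * m - (m + T)) / (2 * m) with hδdef
  have hδ : 0 < δ := div_pos (by linarith) (by linarith)
  have hδm : 2 * (m * δ) = R * m - (m + T) := by rw [hδdef]; field_simp
  set R₁ := (1 + R) / 2 with hR₁
  set κ := (R₁ - 1) * δ / 2 with hκdef
  have hκ : 0 < κ := by
    have : 0 < R₁ - 1 := by linarith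
    positivity
  -- beyond `M`, the dual bound holds for all ratios from `R₁` on
  set M := 2 * R₁ * (T + 1) / (R₁ - 1) with hM
  have hM0 : 0 ≤ M := div_nonneg (by nlinarith) (by linarith)
  obtain ⟨η, hη, h1, h2, h3, h4⟩ : ∃ η : ℝ, 0 < η ∧ η ≤ δ ∧ η ≤ R - R₁ ∧ η * T ≤ κ ∧ η * M ≤ κ := by
    refine ⟨min (min δ (R - R₁)) (κ / (T + M + 1)), ?_, ?_, ?_, ?_, ?_⟩
    · exact lt_min (lt_min hδ (by linarith)) (by positivity)
    · exact (min_le_left _ _).trans (min_le_left _ _)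
    · exact (min_le_left _ _).trans (min_le_right _ _)
    · calc _ ≤ κ / (T + M + 1) * T := mul_le_mul_of_nonneg_right (min_le_right _ _) hs0
        _ ≤ κ / (T + M + 1) * (T + M + 1) := by gcongr; linarith
        _ = κ := by field_simp
    · calc _ ≤ κ / (T + M + 1) * M := mul_le_mul_of_nonneg_right (min_le_right _ _) hM0
        _ ≤ κ / (T + M + 1) * (T + M + 1) := by gcongr; linarith
        _ = κ := by field_simp
  refine ⟨R - η, by linarith, fun i => t i + δ, fun i => by linarith [H.nonneg i],
    fun i j h => by linarith [H.mono h], ?_, fun i y hy => ?_⟩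
  · rw [Finset.sum_add_distrib, Finset.sum_const, Finset.card_univ, Fintype.card_fin,
      nsmul_eq_mul]
    have := mul_le_mul_of_nonneg_left h1 hm'.le
    linarith
  set R' := R - η with hR'
  have hR'1 : R₁ ≤ R' := by linarith
  simp only [availability_add]
  set x := y - δ with hx
  have e1 : ∀ h, y - (availability t i h + δ) = x - availability t i h := fun h => by
    rw [hx]; ring
  simp only [e1]
  set S := ∑ h, (max (x - availability t i h) 0) ^ 2
  have hS : 0 ≤ S := Finset.sum_nonneg fun _ _ => sq_nonneg _
  have hr := H.nonneg i
  have hηr : η * t i ≤ κ := (mul_le_mul_of_nonneg_left (hT i) hη.le).trans h3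
  have hκ2 : 2 * κ ≤ (R' - 1) * δ := by
    have := mul_le_mul_of_nonneg_right (sub_le_sub_right hR'1 1) hδ.le
    linarith
  set l := x - R * t i with hl
  set l' := y - R' * (t i + δ) with hl'
  have hl'0 : 0 ≤ l' := sub_nonneg.2 hy
  have hll' : l' ≤ l - κ := by
    have : l' = l + η * t i - (R' - 1) * δ := by rw [hl', hl, hx, hR']; ring
    linarith
  rcases le_total x M with hxM | hxM
  · have hd := H.dual i x (by linarith)
    have h5 : η * l ≤ R * κ := by
      have h6 : l ≤ x := by
        have : 0 ≤ R * t i := by positivity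
        linarith
      have h7 := mul_le_mul_of_nonneg_left (h6.trans hxM) hη.le
      have h8 := mul_le_mul_of_nonneg_right hR.le hκ.le
      linarith
    have h6 : R * l' ^ 2 ≤ R' * l ^ 2 := by
      have h7 : l' ^ 2 ≤ (l - κ) ^ 2 := pow_le_pow_left₀ hl'0 hll' 2
      have h8 : (l - κ) ^ 2 ≤ l ^ 2 - κ * l := by
        linarith [mul_nonneg hκ.le (by linarith : 0 ≤ l - κ)]
      have h9 := mul_le_mul_of_nonneg_left (h7.trans h8) (by linarith : 0 ≤ R)
      have h10 := mul_le_mul_of_nonneg_right h5 (by linarith : 0 ≤ l)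
      have h11 : R' * l ^ 2 = R * l ^ 2 - η * l * l := by rw [hR']; ring
      linarith
    have h12 : R * (m * l' ^ 2) ≤ R * (R' * S) := by
      have h13 := mul_le_mul_of_nonneg_left h6 hm'.le
      have h14 := mul_le_mul_of_nonneg_left hd (by linarith : 0 ≤ R')
      linarith
    exact le_of_mul_le_mul_left h12 (by linarith)
  · have hA : ∀ h, availability t i h ≤ T + 1 := availability_le hT i
    have hxT : 2 * R₁ * (T + 1) ≤ (R₁ - 1) * x := by
      rw [hM, div_le_iff₀ (by linarith)] at hxM
      linarith
    obtain ⟨hTx, h7⟩ := sq_le_mul_sub_sq (by linarith) (by linarith) hxT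
    have h5 : (m : ℝ) * (x - (T + 1)) ^ 2 ≤ S := by
      have : ∑ h : Fin m, (x - (T + 1)) ^ 2 ≤ S :=
        Finset.sum_le_sum fun h _ => pow_le_pow_left₀ (by linarith)
          (le_max_of_le_left (by linarith [hA h])) 2
      simpa using this
    have h6 : l' ^ 2 ≤ x ^ 2 := by
      have : 0 ≤ R * t i := by positivity
      exact pow_le_pow_left₀ hl'0 (by linarith) 2
    calc (m : ℝ) * l' ^ 2 ≤ m * (R₁ * (x - (T + 1)) ^ 2) := by gcongr; exact h6.trans h7
      _ = R₁ * (m * (x - (T + 1)) ^ 2) := by ring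
      _ ≤ R' * S := mul_le_mul hR'1 h5 (by positivity) (by linarith)

lemma sum_range_mul_div {k : ℕ} (hk : 0 < k) (F : ℕ → ℝ) (l : ℕ) :
    ∑ j ∈ Finset.range (k * l), F (j / k) = k * ∑ i ∈ Finset.range l, F i := by
  induction l with
  | zero => simp
  | succ l ih =>
    rw [Nat.mul_succ, Finset.sum_range_add, ih, Finset.sum_range_succ, mul_add]
    congr 1
    rw [Finset.sum_congr rfl fun j hj => by
      rw [Nat.mul_add_div hk, Nat.div_eq_of_lt (Finset.mem_range.1 hj), add_zero]]
    simp

/-- A sum over `n = q + k m` machines, of which the first `q + k` copy the first one of `m`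
machines, the next `k` the second one, and so on. -/
lemma sum_blowUp {m n k q : ℕ} (hm : 0 < m) (hk : 0 < k) (hn : n = q + k * m)
    (g : Fin n → Fin m) (hg : ∀ j, (g j : ℕ) = (j - q) / k) (F : Fin m → ℝ) :
    ∑ j, F (g j) = q * F ⟨0, hm⟩ + k * ∑ i, F i := by
  subst hn
  set F' : ℕ → ℝ := fun x => if h : x < m then F ⟨x, h⟩ else 0 with hF'
  have hF : ∀ i : Fin m, F i = F' i := fun i => by simp [hF']
  calc ∑ j, F (g j) = ∑ j : Fin (q + k * m), F' ((j - q) / k) :=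
        Finset.sum_congr rfl fun j _ => by rw [hF, hg]
    _ = ∑ j ∈ Finset.range (q + k * m), F' ((j - q) / k) :=
        Fin.sum_univ_eq_sum_range (fun j => F' ((j - q) / k)) _
    _ = ∑ j ∈ Finset.range q, F' 0 + ∑ j ∈ Finset.range (k * m), F' (j / k) := by
        rw [Finset.sum_range_add]
        congr 1
        · refine Finset.sum_congr rfl fun j hj => ?_
          rw [Nat.sub_eq_zero_of_le (Finset.mem_range.1 hj).le, Nat.zero_div]
        · exact Finset.sum_congr rfl fun j _ => by rw [Nat.add_sub_cancel_left]
    _ = _ := by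
        rw [sum_range_mul_div hk, Finset.sum_const, Finset.card_range, nsmul_eq_mul, hF ⟨0, hm⟩,
          ← Fin.sum_univ_eq_sum_range]
        simp only [hF]

/-- Delays for `m` machines, copied `k` times (with `q` more copies of the first one). -/
lemma DualFeasible.blowUp {m n k q : ℕ} (hm : 0 < m) (hk : 0 < k) (hn : n = q + k * m)
    {t : Fin m → ℝ} {R : ℝ} (H : DualFeasible t R)
    (g : Fin n → Fin m) (hg : ∀ j, (g j : ℕ) = (j - q) / k) :
    DualFeasible (fun j => t (g j)) (R * (n / (k * m : ℕ))) := by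
  have hR := H.one_le hm
  have hm' : (0 : ℝ) < m := by exact_mod_cast hm
  have hk' : (0 : ℝ) < k := by exact_mod_cast hk
  have hq' : (0 : ℝ) ≤ q := Nat.cast_nonneg q
  have hnR : (n : ℝ) = q + k * m := by exact_mod_cast hn
  have hn0 : (0 : ℝ) < n := by rw [hnR]; positivity
  have hgm : Monotone g := by
    intro i j hij
    rw [Fin.le_def, hg, hg]
    exact Nat.div_le_div_right (Nat.sub_le_sub_right hij q)
  have h1 : (1 : ℝ) ≤ n / (k * m : ℕ) := by
    push_cast
    rw [le_div_iff₀ (by positivity)]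
    linarith
  have hRle : R ≤ R * (n / (k * m : ℕ)) := le_mul_of_one_le_right (by linarith) h1
  refine ⟨fun j => H.nonneg _, fun i j hij => H.mono (hgm hij), ?_, fun j y hy => ?_⟩
  · rw [sum_blowUp hm hk hn g hg]
    have h2 : (m : ℝ) * t ⟨0, hm⟩ ≤ ∑ i, t i := by
      have : ∑ _i : Fin m, t ⟨0, hm⟩ ≤ ∑ i, t i :=
        Finset.sum_le_sum fun i _ => H.mono (Fin.le_def.2 (Nat.zero_le _))
      simpa using this
    have h3 : (m : ℝ) * (n + (q * t ⟨0, hm⟩ + k * ∑ i, t i)) ≤ m * (R * n) := by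
      have h4 := mul_le_mul_of_nonneg_left h2 hq'
      have h5 := mul_le_mul_of_nonneg_left H.sum_le hn0.le
      rw [hnR] at h5 ⊢
      linarith
    exact (le_of_mul_le_mul_left h3 hm').trans (mul_le_mul_of_nonneg_right hRle hn0.le)
  · have hr := H.nonneg (g j)
    have hy' : R * t (g j) ≤ y := (mul_le_mul_of_nonneg_right hRle hr).trans hy
    have h2 : ∑ h, (max (y - availability t (g j) (g h)) 0) ^ 2 ≤
        ∑ h, (max (y - availability (fun j => t (g j)) j h) 0) ^ 2 := by
      refine Finset.sum_le_sum fun h _ => posPart_sq_mono (sub_le_sub_left ?_ y)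
      unfold availability
      by_cases hh : h ≤ j
      · rw [if_pos hh, if_pos (hgm hh)]
      · rw [if_neg hh]
        exact le_availability t (g j) (g h)
    rw [sum_blowUp hm hk hn g hg (fun i => (max (y - availability t (g j) i) 0) ^ 2)] at h2
    have h3 := H.dual (g j) y hy'
    set S := ∑ h, (max (y - availability t (g j) h) 0) ^ 2
    set S' := ∑ h, (max (y - availability (fun j => t (g j)) j h) 0) ^ 2
    have h4 : (k : ℝ) * S ≤ S' :=
      (le_add_of_nonneg_left (mul_nonneg hq' (sq_nonneg _))).trans h2
    have h5 : (y - R * (n / (k * m : ℕ)) * t (g j)) ^ 2 ≤ (y - R * t (g j)) ^ 2 :=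
      pow_le_pow_left₀ (sub_nonneg.2 hy)
        (sub_le_sub_left (mul_le_mul_of_nonneg_right hRle hr) y) 2
    calc (n : ℝ) * (y - R * (n / (k * m : ℕ)) * t (g j)) ^ 2
        ≤ n * (y - R * t (g j)) ^ 2 := by gcongr
      _ = (n / (k * m : ℕ)) * (k * (m * (y - R * t (g j)) ^ 2)) := by
        push_cast; field_simp
      _ ≤ (n / (k * m : ℕ)) * (k * (R * S)) := by gcongr
      _ = R * (n / (k * m : ℕ)) * (k * S) := by ring
      _ ≤ _ := by gcongr

/-- The index of the job that is copied by job `j`. -/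
lemma exists_blowUp_index {m n k q : ℕ} (hm : 0 < m) (hn : n = q + k * m) :
    ∃ g : Fin n → Fin m, ∀ j, (g j : ℕ) = (j - q) / k :=
  ⟨fun j => ⟨(j - q) / k, by
    have := j.2
    have h : 0 < k * m ∨ j - q = 0 := by
      rcases Nat.eq_zero_or_pos (k * m) with h | h
      · right; omega
      · exact Or.inl h
    rcases h with h | h
    · exact Nat.div_lt_of_lt_mul (by omega)
    · rw [h, Nat.zero_div]; exact hm⟩, fun _ => rfl⟩

lemma one_le_targetRatio {m : ℕ} (hm : 0 < m) : 1 ≤ targetRatio m := by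
  obtain ⟨t, H⟩ := exists_dualFeasible_targetRatio hm
  exact H.one_le hm

/-- The optimal delays for `m` machines are copied `n / m` times. The `n % m` machines left over have a
share of the total delay that vanishes as `n` grows. -/
lemma eventually_targetRatio_le {m : ℕ} (hm : 0 < m) {ε : ℝ} (hε : 0 < ε) :
    ∀ᶠ n in atTop, targetRatio n ≤ targetRatio m + ε := by
  obtain ⟨t, H⟩ := exists_dualFeasible_targetRatio hm
  have hR := H.one_le hm
  have hm' : (0 : ℝ) < m := by exact_mod_cast hm
  obtain ⟨K, hK⟩ := exists_nat_gt (targetRatio m / ε)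
  filter_upwards [eventually_ge_atTop ((K + 1) * m)] with n hn
  have hk : K + 1 ≤ n / m := (Nat.le_div_iff_mul_le hm).2 hn
  have hk0 : 0 < n / m := by omega
  have hdec : n = n % m + n / m * m := by rw [mul_comm]; exact (Nat.mod_add_div n m).symm
  obtain ⟨g, hg⟩ := exists_blowUp_index (k := n / m) hm hdec
  refine (targetRatio_le (by rw [hdec]; positivity) (H.blowUp hm hk0 hdec g hg)).trans ?_
  have hk' : (K : ℝ) + 1 ≤ (n / m : ℕ) := by exact_mod_cast hk
  have hmod : ((n % m : ℕ) : ℝ) ≤ m := by exact_mod_cast (Nat.mod_lt n hm).le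
  have hnR : (n : ℝ) = (n % m : ℕ) + (n / m : ℕ) * m := by exact_mod_cast hdec
  set k : ℝ := ((n / m : ℕ) : ℝ)
  have hkpos : 0 < k := Nat.cast_pos.2 hk0
  push_cast
  rw [mul_div_assoc', div_le_iff₀ (by positivity)]
  have h1 : targetRatio m ≤ ε * k := by
    rw [div_lt_iff₀ hε] at hK
    nlinarith
  have h2 := mul_le_mul_of_nonneg_right h1 hm'.le
  have h3 := mul_le_mul_of_nonneg_left hmod (by linarith : 0 ≤ targetRatio m)
  rw [hnR]
  linarith

lemma availability_mono {m : ℕ} {t t' : Fin m → ℝ} {j : Fin m} (h : ∀ i, t' i ≤ t i) (i : Fin m) :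
    availability t' j i ≤ availability t j i := by
  unfold availability
  split_ifs
  · exact max_le_max (by linarith [h i]) (h j)
  · exact h j

/-- If a machine becomes available one unit of time earlier, then the key pattern may be submitted
a bit earlier. -/
lemma DualBound.exists_advance {m : ℕ} {R r : ℝ} {b : Fin m → ℝ} (hR : 1 < R) (hr : 0 < r)
    (H : DualBound R r b) (h₀ : Fin m) (hb : b h₀ = r + 1) :
    ∃ ε, 0 < ε ∧ ε < r ∧ ∀ b' : Fin m → ℝ, (∀ h, b' h ≤ b h) → b' h₀ ≤ r →
      DualBound R (r - ε) b' := by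
  have hm : 0 < m := (Nat.zero_le _).trans_lt h₀.2
  have hm' : (0 : ℝ) < m := by exact_mod_cast hm
  have hR0 : 0 < R := by linarith
  set c := (R - 1) * r with hcdef
  have hc : 0 < c := mul_pos (by linarith) hr
  set d := min c 1
  have hd : 0 < d := lt_min hc one_pos
  obtain ⟨ε, hε, h1, h2⟩ : ∃ ε : ℝ, 0 < ε ∧ 3 * m * ε ≤ d ∧ 2 * R * ε ≤ c := by
    refine ⟨min (d / (3 * m)) (c / (2 * R)), lt_min (by positivity) (by positivity), ?_, ?_⟩
    · calc 3 * m * _ ≤ 3 * m * (d / (3 * m)) := by gcongr; exact min_le_left _ _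
        _ = d := by field_simp
    · calc 2 * R * _ ≤ 2 * R * (c / (2 * R)) := by gcongr; exact min_le_right _ _
        _ = c := by field_simp
  refine ⟨ε, hε, by nlinarith, fun b' hb' hb₀ y hy => ?_⟩
  have hS : ∑ h, (max (y - b h) 0) ^ 2 + ((max (y - r) 0) ^ 2 - (max (y - r - 1) 0) ^ 2) ≤
      ∑ h, (max (y - b' h) 0) ^ 2 := by
    rw [← Finset.add_sum_erase _ (fun h => (max (y - b h) 0) ^ 2) (Finset.mem_univ h₀),
      ← Finset.add_sum_erase _ (fun h => (max (y - b' h) 0) ^ 2) (Finset.mem_univ h₀),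
      hb, sub_sub]
    have e1 := posPart_sq_mono (sub_le_sub_left hb₀ y)
    have e2 : ∑ h ∈ Finset.univ.erase h₀, (max (y - b h) 0) ^ 2 ≤
        ∑ h ∈ Finset.univ.erase h₀, (max (y - b' h) 0) ^ 2 :=
      Finset.sum_le_sum fun h _ => posPart_sq_mono (sub_le_sub_left (hb' h) y)
    linarith
  refine le_trans ?_ (mul_le_mul_of_nonneg_left hS hR0.le)
  have hS0 : 0 ≤ ∑ h, (max (y - b h) 0) ^ 2 := by positivity
  set S := ∑ h, (max (y - b h) 0) ^ 2
  have hRε : 0 < R * ε := by positivity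
  rcases le_total (R * r) y with h | h
  · have hd1 := H y h
    set w := y - r with hw
    have hwc : c ≤ w := by rw [hcdef]; linarith
    have hw0 : 0 < w := by linarith
    have h3 : w * d ≤ (max w 0) ^ 2 - (max (w - 1) 0) ^ 2 := by
      rw [max_eq_left hw0.le]
      rcases le_total w 1 with h' | h'
      · rw [max_eq_right (by linarith)]
        have : w * d ≤ w * w :=
          mul_le_mul_of_nonneg_left ((min_le_left _ _).trans hwc) hw0.le
        linarith
      · rw [max_eq_left (by linarith)]
        have : w * d ≤ w * 1 := mul_le_mul_of_nonneg_left (min_le_right _ _) hw0.le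
        linarith
    set l := y - R * r with hl
    have hlw : l ≤ w := by rw [hl, hw]; nlinarith
    have h4 : y - R * (r - ε) = l + R * ε := by rw [hl]; ring
    rw [h4]
    have h5 : (l + R * ε) ^ 2 ≤ l ^ 2 + R * (3 * ε * w) := by
      have e1 := mul_le_mul_of_nonneg_left hlw hRε.le
      have e2 : R * ε * (R * ε) ≤ R * ε * w := mul_le_mul_of_nonneg_left (by linarith) hRε.le
      linarith
    have h6 := mul_le_mul_of_nonneg_left h5 hm'.le
    have h7 := mul_le_mul_of_nonneg_right h1 (by positivity : 0 ≤ R * w)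
    have h8 := mul_le_mul_of_nonneg_left h3 hR0.le
    linarith
  · have h3 : (y - R * (r - ε)) ^ 2 ≤ (R * ε) ^ 2 :=
      pow_le_pow_left₀ (by linarith) (by linarith) 2
    have h4 : c / 2 ≤ y - r := by rw [hcdef] at h2 ⊢; linarith
    have h5 : (c / 4) * d ≤ (max (y - r) 0) ^ 2 - (max (y - r - 1) 0) ^ 2 := by
      have hw0 : 0 < y - r := by linarith
      rw [max_eq_left hw0.le]
      rcases le_total (y - r) 1 with h' | h'
      · rw [max_eq_right (by linarith)]
        have e1 : d ≤ c := min_le_left _ _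
        nlinarith
      · rw [max_eq_left (by linarith)]
        have e1 : d ≤ 1 := min_le_right _ _
        nlinarith
    have h6 := mul_le_mul_of_nonneg_left h3 hm'.le
    have h7 : m * (R * ε) ^ 2 ≤ R * ((c / 4) * d) := by
      have e1 : m * (R * ε) ^ 2 = R * ((R * ε) * (m * ε)) := by ring
      rw [e1]
      refine mul_le_mul_of_nonneg_left ?_ hR0.le
      have e2 : R * ε * (m * ε) ≤ c / 2 * (d / 3) :=
        mul_le_mul (by linarith) (by linarith) (by positivity) (by positivity)
      linarith [mul_pos hc hd]
    have h8 := mul_le_mul_of_nonneg_left h5 hR0.le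
    have h9 : 0 ≤ R * S := by positivity
    linarith

/-- Doubling the number of machines decreases the target ratio: in the doubled optimal delay
sequence, the first job with a positive delay can start earlier. -/
lemma targetRatio_two_mul_lt {m : ℕ} (hm : 0 < m) : targetRatio (2 * m) < targetRatio m := by
  obtain ⟨t, H⟩ := exists_dualFeasible_targetRatio hm
  set R := targetRatio m
  have hm' : (0 : ℝ) < m := by exact_mod_cast hm
  have hex : ∃ n : ℕ, ∃ h : n < m, 0 < t ⟨n, h⟩ := by
    by_contra! hcon
    have h0 : ∀ i, t i = 0 := fun i => le_antisymm (hcon i i.2) (H.nonneg i)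
    have h1 := H.dual ⟨m - 1, by omega⟩ 1 (by rw [h0]; simp)
    have h2 : ∀ h, availability t ⟨m - 1, by omega⟩ h = 1 := by
      intro h
      have : h ≤ ⟨m - 1, by omega⟩ := Fin.le_def.2 (by simp; omega)
      rw [availability, if_pos this, h0, h0]; norm_num
    simp only [h2, h0] at h1
    norm_num at h1
    omega
  obtain ⟨hi, hti⟩ := Nat.find_spec hex
  have hmin : ∀ h : Fin m, (h : ℕ) < Nat.find hex → t h = 0 := fun h hh => by
    by_contra hne
    exact Nat.find_min hex hh ⟨h.2, lt_of_le_of_ne (H.nonneg h) (Ne.symm hne)⟩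
  set i := Nat.find hex
  have hR : 1 < R := by
    have h1 := Finset.single_le_sum (fun j _ => H.nonneg j) (Finset.mem_univ ⟨i, hi⟩)
    have h2 := H.sum_le
    by_contra! h
    nlinarith
  have hn : 2 * m = 0 + 2 * m := (zero_add _).symm
  obtain ⟨g, hg⟩ := exists_blowUp_index (k := 2) hm hn
  have H2 := H.blowUp hm two_pos hn g hg
  simp only [Nat.sub_zero] at hg
  rw [div_self (by positivity), mul_one] at H2
  set t₂ : Fin (2 * m) → ℝ := fun j => t (g j)
  let j₀ : Fin (2 * m) := ⟨2 * i, by omega⟩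
  let j₁ : Fin (2 * m) := ⟨2 * i + 1, by omega⟩
  have hg0 : g j₀ = ⟨i, hi⟩ := Fin.ext (by rw [hg]; simp [j₀])
  have hg1 : g j₁ = ⟨i, hi⟩ := Fin.ext (by rw [hg]; simp only [j₁]; omega)
  have hr : 0 < t₂ j₀ := by simp only [t₂, hg0]; exact hti
  have h01 : t₂ j₁ = t₂ j₀ := by simp only [t₂, hg0, hg1]
  have hd := H2.dual j₁
  rw [h01] at hd
  obtain ⟨ε, hε, hεr, hadv⟩ := hd.exists_advance hR hr j₁ (by
    rw [availability, if_pos le_rfl, h01, max_eq_left (by linarith)])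
  set t₃ : Fin (2 * m) → ℝ := fun j => if j = j₀ then t₂ j₀ - ε else t₂ j with ht₃
  have h32 : ∀ j, t₃ j ≤ t₂ j := by
    intro j
    simp only [ht₃]
    split_ifs with h
    · rw [h]; linarith
    · exact le_rfl
  have hnn : ∀ j, 0 ≤ t₃ j := by
    intro j
    simp only [ht₃]
    split_ifs with h
    · linarith
    · exact H2.nonneg j
  have hsum : ∑ j, t₃ j = ∑ j, t₂ j - ε := by
    rw [← Finset.add_sum_erase _ t₃ (Finset.mem_univ j₀),
      ← Finset.add_sum_erase _ t₂ (Finset.mem_univ j₀),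
      Finset.sum_congr rfl fun j hj => show t₃ j = t₂ j from if_neg (Finset.ne_of_mem_erase hj)]
    simp only [ht₃, if_true]
    ring
  have H3 : DualFeasible t₃ R := by
    refine ⟨hnn, ?_, by rw [hsum]; linarith [H2.sum_le], ?_⟩
    · intro j j' hjj
      by_cases h : j' = j₀
      · by_cases h' : j = j₀
        · rw [h, h']
        · -- all jobs before the first delayed one have delay zero
          have h0 : t₂ j = 0 := by
            apply hmin
            rw [hg]
            have h1 : (j : ℕ) ≤ 2 * i := by rw [h] at hjj; exact hjj
            have h2 : (j : ℕ) ≠ 2 * i := fun h2 => h' (Fin.ext h2)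
            omega
          calc t₃ j = 0 := by simp only [ht₃]; rw [if_neg h', h0]
            _ ≤ t₃ j' := hnn j'
      · calc t₃ j ≤ t₂ j := h32 j
          _ ≤ t₂ j' := H2.mono hjj
          _ = t₃ j' := by simp only [ht₃]; rw [if_neg h]
    · intro j
      by_cases h : j = j₀
      · subst h
        have hj : t₃ j₀ = t₂ j₀ - ε := by simp [ht₃]
        rw [hj]
        refine hadv _ (fun h => ?_) ?_
        · refine (availability_mono h32 h).trans ?_
          unfold availability
          rw [h01]
          by_cases hh : h ≤ j₀
          · rw [if_pos hh, if_pos (hh.trans (Fin.le_def.2 (by simp [j₀, j₁])))]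
          · rw [if_neg hh]
            split_ifs
            · exact le_max_right _ _
            · exact le_rfl
        · have : ¬ j₁ ≤ j₀ := by rw [Fin.le_def]; simp [j₀, j₁]
          rw [availability, if_neg this, hj]
          linarith
      · have hj : t₃ j = t₂ j := by simp only [ht₃]; rw [if_neg h]
        rw [hj]
        exact (H2.dual j).mono (by linarith) (availability_mono h32)
  obtain ⟨R', hR', t', H'⟩ := exists_lt_dualFeasible (by omega) H3 (by
    rw [hsum]; linarith [H2.sum_le])
  exact (targetRatio_le (by omega) H').trans_lt hR'

/-- The target ratio converges, and its limit lies strictly below all its values. -/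
lemma exists_tendsto_targetRatio :
    ∃ L : ℝ, Tendsto targetRatio atTop (𝓝 L) ∧ ∀ m : ℕ, 0 < m → L < targetRatio m := by
  set s : Set ℝ := targetRatio '' {m | 0 < m}
  have hbdd : BddBelow s := ⟨1, by
    rintro _ ⟨m, hm, rfl⟩
    exact one_le_targetRatio hm⟩
  have hne : s.Nonempty := ⟨_, 1, Nat.one_pos, rfl⟩
  have hle : ∀ m : ℕ, 0 < m → sInf s ≤ targetRatio m := fun m hm => csInf_le hbdd ⟨m, hm, rfl⟩
  refine ⟨sInf s, ?_, fun m hm =>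
    (hle _ (by omega)).trans_lt (targetRatio_two_mul_lt hm)⟩
  rw [tendsto_order]
  constructor
  · intro a ha
    filter_upwards [eventually_gt_atTop 0] with n hn
    exact ha.trans_le (hle n hn)
  · intro a ha
    obtain ⟨_, ⟨m, hm, rfl⟩, hma⟩ := exists_lt_of_csInf_lt hne ha
    filter_upwards [eventually_targetRatio_le hm (half_pos (sub_pos.2 hma))] with n hn
    linarith

/-! ### Two machines -/

/-- A lower bound on the delay `t i` from a lower bound on the availabilities: the key pattern
submitted at time `τ` would violate the ratio. -/
lemma DualBound.le_of_not {m : ℕ} {R r τ : ℝ} {a b : Fin m → ℝ} (hR : 1 ≤ R)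
    (H : DualBound R r a) (hab : r ≤ τ → ∀ h, b h ≤ a h + (τ - r)) (hb : ¬ DualBound R τ b) :
    τ ≤ r := by
  by_contra! hlt
  have h1 := H.shift hR (sub_nonneg.2 hlt.le)
  rw [add_sub_cancel] at h1
  exact hb (h1.mono (by linarith) (hab hlt.le))

/-- At ratio `1.546095` the first job cannot start before `0.238985`, so the second one cannot start
before `0.853211`, and the total delay is too large. The multipliers approximate the vertices of the
two quadratics in question. -/
lemma targetRatio_two_gt : 1.546095 < targetRatio 2 := by
  obtain ⟨t, H⟩ := exists_dualFeasible_targetRatio two_pos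
  by_contra! hR
  replace H := H.mono_ratio hR
  have h1 : (0.238985 : ℝ) ≤ t 0 := by
    refine (H.dual 0).le_of_not (b := ![1.238985, 0.238985]) (by norm_num) (fun hr h => ?_)
      fun hcon => ?_
    · fin_cases h
      · simp [availability]; linarith [le_max_left (t 0 + 1) (t 0)]
      · simp [availability]
    · have := hcon 1.4155916 (by norm_num)
      simp only [Fin.sum_univ_two, Matrix.cons_val_zero, Matrix.cons_val_one] at this
      norm_num at this
  have h2 : (0.853211 : ℝ) ≤ t 1 := by
    refine (H.dual 1).le_of_not (b := ![1.238985, 1.853211]) (by norm_num) (fun hr h => ?_)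
      fun hcon => ?_
    · fin_cases h
      · simp [availability]; linarith [le_max_left (t 0 + 1) (t 1)]
      · simp [availability]; linarith [le_max_left (t 1 + 1) (t 1)]
    · have := hcon 1.9616887 (by norm_num)
      simp only [Fin.sum_univ_two, Matrix.cons_val_zero, Matrix.cons_val_one] at this
      norm_num at this
  have h3 := H.sum_le
  rw [Fin.sum_univ_two] at h3
  norm_num at h3
  linarith

/-- The delays approximate those of the lower bound. Each dual bound is a quadratic inequality on
either side of the time when the last machine becomes available; the hints are its vertices. -/
lemma targetRatio_two_le : targetRatio 2 ≤ 1.546105 := by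
  refine targetRatio_le two_pos (t := ![0.23898, 0.85321]) ⟨fun i => ?_, ?_, ?_, fun i => ?_⟩
  · fin_cases i <;> norm_num
  · intro i j hij
    fin_cases i <;> fin_cases j <;> first | exact absurd hij (by decide) | norm_num
  · rw [Fin.sum_univ_two]; norm_num
  · intro y hy
    fin_cases i
    · simp only [Fin.sum_univ_two, availability] at hy ⊢
      norm_num at hy ⊢
      rw [max_eq_left (a := y - _) (by linarith : (0 : ℝ) ≤ y - 11949 / 50000)]
      rcases le_total y 1.23898 with h | h
      · have : 0 ≤ (max (y - 61949 / 50000) 0) ^ 2 := by positivity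
        nlinarith
      · rw [max_eq_left (by linarith)]
        nlinarith [sq_nonneg (y - 1.41558)]
    · simp only [Fin.sum_univ_two, availability] at hy ⊢
      norm_num at hy ⊢
      rw [max_eq_left (by linarith : (0 : ℝ) ≤ y - 61949 / 50000)]
      rcases le_total y 1.85321 with h | h
      · have : 0 ≤ (max (y - 185321 / 100000) 0) ^ 2 := by positivity
        nlinarith
      · rw [max_eq_left (by linarith)]
        nlinarith [sq_nonneg (y - 1.96168)]

/-! ### The adversary -/

lemma Instance.r_nonneg (I : Instance) (j : Fin I.n) : 0 ≤ I.r j := by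
  rw [← I.r_first]
  exact I.r_mono (Fin.le_def.2 (Nat.zero_le _))

lemma Schedule.Feasible.sum_p_le {I : Instance} {m : ℕ} {S : Schedule I m} (hS : S.Feasible) :
    ∑ j, I.p j ≤ S.cost :=
  Finset.sum_le_sum fun j _ => by
    have h1 := I.r_nonneg j
    have h2 := hS.1 j
    rw [Schedule.completion]; linarith

lemma Instance.sum_p_pos (I : Instance) : 0 < ∑ j, I.p j :=
  Finset.sum_pos (fun j _ => I.p_pos j) ⟨⟨0, I.n_pos⟩, Finset.mem_univ _⟩

lemma Instance.opt_le {I : Instance} {m : ℕ} {S : Schedule I m} (hS : S.Feasible) :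
    I.opt m ≤ S.cost := by
  refine csInf_le ⟨∑ j, I.p j, ?_⟩ ⟨S, hS, rfl⟩
  rintro _ ⟨S', hS', rfl⟩
  exact hS'.sum_p_le

lemma Instance.opt_pos {I : Instance} {m : ℕ} {S : Schedule I m} (hS : S.Feasible) :
    0 < I.opt m := by
  refine I.sum_p_pos.trans_le (le_csInf ⟨_, S, hS, rfl⟩ ?_)
  rintro _ ⟨S', hS', rfl⟩
  exact hS'.sum_p_le

lemma OnlineAlgorithm.cost_le {m : ℕ} (A : OnlineAlgorithm m) {R : ℝ}
    (hA : A.competitiveRatio ≤ (R : EReal)) {I : Instance} {S : Schedule I m} (hS : S.Feasible) :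
    (A.schedule I).cost ≤ R * S.cost := by
  have h1 : (A.schedule I).cost / I.opt m ≤ R := by
    have : (((A.schedule I).cost / I.opt m : ℝ) : EReal) ≤ (R : EReal) :=
      (le_iSup (fun I : Instance => (((A.schedule I).cost / I.opt m : ℝ) : EReal)) I).trans hA
    exact_mod_cast this
  have h2 := Instance.opt_pos hS
  have h3 := I.sum_p_pos.trans_le (A.feasible I).sum_p_le
  have h4 : 0 ≤ R := (div_pos h3 h2).le.trans h1
  rw [div_le_iff₀ h2] at h1
  exact h1.trans (mul_le_mul_of_nonneg_left (Instance.opt_le hS) h4)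

/-- The long jobs: `m` jobs of processing time `1`, submitted at time `0`. -/
def longJobs {m : ℕ} (hm : 0 < m) : Instance where
  n := m
  p _ := 1
  r _ := 0
  n_pos := hm
  p_pos _ := one_pos
  r_mono _ _ _ := le_rfl
  r_first := rfl

/-- The long jobs, followed by the key pattern: `k * m` jobs of processing time `ε`, submitted at
time `r`. -/
noncomputable def keyPattern {m : ℕ} (hm : 0 < m) (k : ℕ) {ε r : ℝ} (hε : 0 < ε) (hr : 0 ≤ r) :
    Instance where
  n := m + k * m
  p j := if (j : ℕ) < m then 1 else ε
  r j := if (j : ℕ) < m then 0 else r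
  n_pos := by omega
  p_pos j := by split_ifs <;> [exact one_pos; exact hε]
  r_mono i j hij := by
    have : (i : ℕ) ≤ j := hij
    dsimp only
    split_ifs
    · exact le_rfl
    · exact hr
    · omega
    · exact le_rfl
  r_first := if_pos hm

lemma revealed_longJobs_eq {m : ℕ} (hm : 0 < m) (k : ℕ) {ε r τ : ℝ} (hε : 0 < ε) (hr : 0 ≤ r)
    (hτ : τ < r) : (longJobs hm).revealed τ = (keyPattern hm k hε hr).revealed τ := by
  ext x
  constructor
  · rintro ⟨j, hj, rfl⟩
    have hjm : (j : ℕ) < m := j.2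
    refine ⟨⟨j, hjm.trans_le (Nat.le_add_right _ _)⟩, ?_, ?_⟩
    · simp only [keyPattern]
      rw [if_pos hjm]; exact hj
    · simp only [keyPattern, longJobs]
      rw [if_pos hjm, if_pos hjm]
  · rintro ⟨j, hj, rfl⟩
    have hjm : (j : ℕ) < m := by
      by_contra hjm
      simp only [keyPattern] at hj
      rw [if_neg hjm] at hj
      exact absurd hj (not_le.2 hτ)
    refine ⟨⟨j, hjm⟩, ?_, ?_⟩
    · simp only [keyPattern] at hj
      rw [if_pos hjm] at hj
      exact hj
    · simp only [keyPattern, longJobs]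
      rw [if_pos hjm, if_pos hjm]

/-- Every long job on a machine of its own, without delay. -/
noncomputable def longJobsSchedule {m : ℕ} (hm : 0 < m) : Schedule (longJobs hm) m where
  start _ := 0
  machine j := j

lemma longJobsSchedule_feasible {m : ℕ} (hm : 0 < m) : (longJobsSchedule hm).Feasible :=
  ⟨fun _ => le_rfl, fun _ _ hij h => absurd h hij⟩

lemma longJobsSchedule_cost {m : ℕ} (hm : 0 < m) : (longJobsSchedule hm).cost = m := by
  simp only [Schedule.cost, Schedule.completion, longJobsSchedule, longJobs]
  simp only [zero_add, Finset.sum_const, nsmul_eq_mul, mul_one]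
  exact congrArg Nat.cast (Finset.card_fin m)

/-- The small jobs of the key pattern are spread evenly over the machines, from their submission
on, and the long jobs follow. -/
noncomputable def keyPatternSchedule {m : ℕ} (hm : 0 < m) (k : ℕ) {ε r : ℝ} (hε : 0 < ε)
    (hr : 0 ≤ r) : Schedule (keyPattern hm k hε hr) m where
  start j := if (j : ℕ) < m then r + k * ε else r + (((j : ℕ) / m : ℕ) - 1) * ε
  machine j := ⟨(j : ℕ) % m, Nat.mod_lt _ hm⟩

lemma keyPatternSchedule_feasible {m : ℕ} (hm : 0 < m) (k : ℕ) {ε r : ℝ} (hε : 0 < ε)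
    (hr : 0 ≤ r) : (keyPatternSchedule hm k hε hr).Feasible := by
  have hdiv : ∀ j : ℕ, ¬ j < m → (1 : ℝ) ≤ (j / m : ℕ) := fun j hj => by
    exact_mod_cast (Nat.one_le_div_iff hm).2 (not_lt.1 hj)
  constructor
  · intro j
    simp only [keyPattern, keyPatternSchedule]
    split_ifs with h
    · positivity
    · have := mul_nonneg (sub_nonneg.2 (hdiv j h)) hε.le
      linarith
  · -- small jobs complete before the long jobs start
    have hsl : ∀ j : ℕ, j < m + k * m → ((j / m : ℕ) : ℝ) * ε ≤ k * ε := fun j hj => by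
      have : j / m < k + 1 := Nat.div_lt_of_lt_mul (by linarith)
      have : ((j / m : ℕ) : ℝ) ≤ k := by exact_mod_cast Nat.lt_succ_iff.1 this
      gcongr
    intro i j hij hmach
    have hmod : (i : ℕ) % m = (j : ℕ) % m := congrArg Fin.val hmach
    have hne : (i : ℕ) ≠ j := fun h => hij (Fin.ext h)
    have hi := i.2
    have hj := j.2
    simp only [Schedule.completion, keyPattern, keyPatternSchedule] at hi hj ⊢
    split_ifs with h1 h2 h2
    · rw [Nat.mod_eq_of_lt h1, Nat.mod_eq_of_lt h2] at hmod
      exact absurd hmod hne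
    · right; linarith [hsl j hj]
    · left; linarith [hsl i hi]
    · have hdne : (i : ℕ) / m ≠ (j : ℕ) / m := fun h => hne (by
        rw [← Nat.div_add_mod (i : ℕ) m, ← Nat.div_add_mod (j : ℕ) m, h, hmod])
      rcases lt_or_gt_of_ne hdne with h | h
      · left
        have : (((i : ℕ) / m : ℕ) : ℝ) + 1 ≤ ((j : ℕ) / m : ℕ) := by exact_mod_cast h
        have := mul_le_mul_of_nonneg_right this hε.le
        linarith
      · right
        have : (((j : ℕ) / m : ℕ) : ℝ) + 1 ≤ ((i : ℕ) / m : ℕ) := by exact_mod_cast h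
        have := mul_le_mul_of_nonneg_right this hε.le
        linarith

lemma keyPatternSchedule_cost {m : ℕ} (hm : 0 < m) (k : ℕ) {ε r : ℝ} (hε : 0 < ε) (hr : 0 ≤ r) :
    (keyPatternSchedule hm k hε hr).cost =
      m * (r + k * ε + 1) + m * (k * r + ε * (k * (k + 1) / 2)) := by
  have h1 : (keyPatternSchedule hm k hε hr).cost = ∑ j : Fin (m + k * m),
      ((if (j : ℕ) < m then r + k * ε else r + (((j : ℕ) / m : ℕ) - 1) * ε) +
        if (j : ℕ) < m then 1 else ε) := rfl
  rw [h1, Fin.sum_univ_eq_sum_range (fun j =>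
      (if j < m then r + k * ε else r + ((j / m : ℕ) - 1) * ε) + if j < m then 1 else ε),
    Finset.sum_range_add]
  congr 1
  · rw [Finset.sum_congr rfl fun j hj => by
      rw [if_pos (Finset.mem_range.1 hj), if_pos (Finset.mem_range.1 hj)]]
    simp; ring
  · rw [Finset.sum_congr rfl fun j _ => show _ = (fun a : ℕ => r + (a + 1) * ε) (j / m) by
      rw [if_neg (by omega), if_neg (by omega), Nat.add_div_left _ hm]
      push_cast; ring]
    rw [mul_comm k m, sum_range_mul_div hm (fun a : ℕ => r + (a + 1) * ε)]
    congr 1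
    induction k with
    | zero => simp
    | succ k ih =>
      rw [Finset.sum_range_succ, ih rfl]
      push_cast; ring

/-- Each of the jobs on a single machine, available from time `b` on, contributes at most its part
of the integral of `max (C - x) 0`. -/
lemma sum_machine_le {ι : Type*} [DecidableEq ι] (s : Finset ι) (σ : ι → ℝ) {ε b C : ℝ}
    (hε : 0 < ε) (hb : ∀ j ∈ s, b ≤ σ j)
    (hs : ∀ i ∈ s, ∀ j ∈ s, i ≠ j → σ i + ε ≤ σ j ∨ σ j + ε ≤ σ i) :
    ∑ j ∈ s, ε * (C - (σ j + ε)) ≤ (max (C - b) 0) ^ 2 / 2 := by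
  set Φ : ℝ → ℝ := fun x => (max (C - x) 0) ^ 2 / 2 with hΦ
  have hanti : ∀ x y, x ≤ y → Φ y ≤ Φ x := fun x y h => by
    have := posPart_sq_mono (sub_le_sub_left h C)
    simp only [hΦ]; linarith
  have h1 : ∀ x, ε * (C - (x + ε)) ≤ Φ x - Φ (x + ε) := by
    intro x
    simp only [hΦ]
    rcases le_total (C - (x + ε)) 0 with h | h
    · rw [max_eq_right h]
      have : ε * (C - (x + ε)) ≤ 0 := mul_nonpos_of_nonneg_of_nonpos hε.le h
      have : 0 ≤ (max (C - x) 0) ^ 2 := sq_nonneg _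
      linarith
    · rw [max_eq_left h, max_eq_left (by linarith)]
      linarith [sq_nonneg ε]
  -- the increments of the antitone function `Φ` over disjoint intervals telescope
  have h2 : ∀ s : Finset ι, (∀ j ∈ s, b ≤ σ j) →
      (∀ i ∈ s, ∀ j ∈ s, i ≠ j → σ i + ε ≤ σ j ∨ σ j + ε ≤ σ i) →
      ∀ T, b ≤ T → (∀ j ∈ s, σ j + ε ≤ T) → ∑ j ∈ s, (Φ (σ j) - Φ (σ j + ε)) ≤ Φ b - Φ T := by
    intro s
    refine Finset.induction_on_max_value σ s ?_ ?_
    · intro _ _ T hT _; simpa using hanti _ _ hT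
    · intro a s ha hmax ih hb hs T hT hsT
      rw [Finset.sum_insert ha]
      have h3 := ih (fun j hj => hb j (Finset.mem_insert_of_mem hj))
        (fun i hi j hj => hs i (Finset.mem_insert_of_mem hi) j (Finset.mem_insert_of_mem hj))
        (σ a) (hb a (Finset.mem_insert_self _ _)) (fun j hj => by
          have hne : j ≠ a := fun h => ha (h ▸ hj)
          rcases hs j (Finset.mem_insert_of_mem hj) a (Finset.mem_insert_self _ _) hne with h | h
          · exact h
          · linarith [hmax j hj])
      have h4 := hanti _ _ (hsT a (Finset.mem_insert_self _ _))
      linarith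
  obtain ⟨T, hT⟩ := (insert b (s.image fun j => σ j + ε)).exists_le
  have h3 := h2 s hb hs T (hT b (Finset.mem_insert_self _ _)) fun j hj =>
    hT _ (Finset.mem_insert_of_mem (Finset.mem_image_of_mem _ hj))
  have h4 : 0 ≤ Φ T := by simp only [hΦ]; positivity
  calc ∑ j ∈ s, ε * (C - (σ j + ε)) ≤ ∑ j ∈ s, (Φ (σ j) - Φ (σ j + ε)) :=
        Finset.sum_le_sum fun j _ => h1 _
    _ ≤ Φ b := by linarith

/-! ### Cubic delay profiles and their moments -/

/-- A cubic polynomial vanishing at `0`. -/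
noncomputable def cubic (c₁ c₂ c₃ u : ℝ) : ℝ := c₁ * u + c₂ * u ^ 2 + c₃ * u ^ 3

/-- The integral of `cubic c₁ c₂ c₃` from `0` to `u`. -/
noncomputable def cubicInt (c₁ c₂ c₃ u : ℝ) : ℝ :=
  c₁ * u ^ 2 / 2 + c₂ * u ^ 3 / 3 + c₃ * u ^ 4 / 4

/-- The integral of the square of `cubic c₁ c₂ c₃` from `0` to `u`. -/
noncomputable def cubicSqInt (c₁ c₂ c₃ u : ℝ) : ℝ :=
  c₁ ^ 2 * u ^ 3 / 3 + c₁ * c₂ * u ^ 4 / 2 + (c₂ ^ 2 + 2 * c₁ * c₃) * u ^ 5 / 5 +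
    c₂ * c₃ * u ^ 6 / 3 + c₃ ^ 2 * u ^ 7 / 7

/-- A delay profile: the jobs up to the fraction `x₀` of all jobs start without delay, and from
there on the delay is a cubic polynomial in the fraction of jobs started. -/
noncomputable def profile (x₀ c₁ c₂ c₃ x : ℝ) : ℝ := cubic c₁ c₂ c₃ (max (x - x₀) 0)

lemma profile_of_le {x₀ c₁ c₂ c₃ x : ℝ} (h : x ≤ x₀) : profile x₀ c₁ c₂ c₃ x = 0 := by
  rw [profile, max_eq_right (by linarith)]; simp [cubic]

lemma profile_of_ge {x₀ c₁ c₂ c₃ x : ℝ} (h : x₀ ≤ x) :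
    profile x₀ c₁ c₂ c₃ x = cubic c₁ c₂ c₃ (x - x₀) := by
  rw [profile, max_eq_left (by linarith)]

lemma profile_monotoneOn {x₀ c₁ c₂ c₃ : ℝ} (h₀ : x₀ ≤ 1)
    (h : MonotoneOn (cubic c₁ c₂ c₃) (Set.Icc 0 (1 - x₀))) :
    MonotoneOn (profile x₀ c₁ c₂ c₃) (Set.Iic 1) := by
  intro x hx y hy hxy
  rw [Set.mem_Iic] at hx hy
  exact h ⟨le_max_right _ _, max_le (by linarith) (by linarith)⟩
    ⟨le_max_right _ _, max_le (by linarith) (by linarith)⟩ (max_le_max (by linarith) le_rfl)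

lemma cubic_monotoneOn {c₁ c₂ c₃ b : ℝ}
    (h : ∀ u ∈ Set.Icc 0 b, 0 ≤ c₁ + 2 * c₂ * u + 3 * c₃ * u ^ 2) :
    MonotoneOn (cubic c₁ c₂ c₃) (Set.Icc 0 b) := by
  have hd : ∀ u, HasDerivAt (cubic c₁ c₂ c₃) (c₁ + 2 * c₂ * u + 3 * c₃ * u ^ 2) u := by
    intro u
    unfold cubic
    have := (((hasDerivAt_id u).const_mul c₁).add ((hasDerivAt_pow 2 u).const_mul c₂)).add
      ((hasDerivAt_pow 3 u).const_mul c₃)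
    exact this.congr_deriv (by norm_num; ring)
  refine monotoneOn_of_deriv_nonneg (convex_Icc _ _)
    (fun u _ => (hd u).continuousAt.continuousWithinAt)
    (fun u _ => (hd u).differentiableAt.differentiableWithinAt) fun u hu => ?_
  rw [(hd u).deriv]
  exact h u (interior_subset hu)

lemma continuous_profile (x₀ c₁ c₂ c₃ : ℝ) : Continuous (profile x₀ c₁ c₂ c₃) := by
  unfold profile cubic; fun_prop

lemma integral_eq_of_shift {f F g : ℝ → ℝ} {x₀ x : ℝ} (h₀ : 0 ≤ x₀) (hx : x₀ ≤ x)
    (hf : Continuous f) (hf₀ : ∀ y ≤ x₀, f y = 0) (hfg : ∀ y, x₀ ≤ y → f y = g (y - x₀))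
    (hg : Continuous g) (hF : ∀ u, HasDerivAt F (g u) u) (hF₀ : F 0 = 0) :
    ∫ y in (0 : ℝ)..x, f y = F (x - x₀) := by
  rw [← intervalIntegral.integral_add_adjacent_intervals (b := x₀)
    (hf.intervalIntegrable _ _) (hf.intervalIntegrable _ _)]
  have h1 : ∫ y in (0 : ℝ)..x₀, f y = 0 := by
    rw [intervalIntegral.integral_congr (g := fun _ => 0)]
    · simp
    · intro y hy
      rw [Set.uIcc_of_le h₀] at hy
      exact hf₀ y hy.2
  have h2 : ∫ y in x₀..x, f y = ∫ y in x₀..x, g (y - x₀) := by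
    apply intervalIntegral.integral_congr
    intro y hy
    rw [Set.uIcc_of_le hx] at hy
    exact hfg y hy.1
  rw [h1, h2, intervalIntegral.integral_comp_sub_right, sub_self,
    intervalIntegral.integral_eq_sub_of_hasDerivAt (fun u _ => hF u) (hg.intervalIntegrable _ _),
    hF₀]
  ring

lemma integral_profile {x₀ c₁ c₂ c₃ x : ℝ} (h₀ : 0 ≤ x₀) (hx : x₀ ≤ x) :
    ∫ y in (0 : ℝ)..x, profile x₀ c₁ c₂ c₃ y = cubicInt c₁ c₂ c₃ (x - x₀) := by
  refine integral_eq_of_shift h₀ hx (continuous_profile _ _ _ _) (fun y => profile_of_le)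
    (fun y => profile_of_ge) (by unfold cubic; fun_prop) (fun u => ?_) (by simp [cubicInt])
  unfold cubicInt cubic
  have := ((((hasDerivAt_pow 2 u).const_mul c₁).div_const 2).add
    (((hasDerivAt_pow 3 u).const_mul c₂).div_const 3)).add
    (((hasDerivAt_pow 4 u).const_mul c₃).div_const 4)
  exact this.congr_deriv (by norm_num; ring)

lemma integral_profile_sq {x₀ c₁ c₂ c₃ x : ℝ} (h₀ : 0 ≤ x₀) (hx : x₀ ≤ x) :
    ∫ y in (0 : ℝ)..x, profile x₀ c₁ c₂ c₃ y ^ 2 = cubicSqInt c₁ c₂ c₃ (x - x₀) := by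
  refine integral_eq_of_shift (g := fun u => cubic c₁ c₂ c₃ u ^ 2) h₀ hx
    ((continuous_profile _ _ _ _).pow 2) (fun y hy => ?_) (fun y hy => ?_)
    (by unfold cubic; fun_prop) (fun u => ?_) (by simp [cubicSqInt])
  · rw [profile_of_le hy]; norm_num
  · rw [profile_of_ge hy]
  unfold cubicSqInt cubic
  have := ((((((hasDerivAt_pow 3 u).const_mul (c₁ ^ 2)).div_const 3).add
    (((hasDerivAt_pow 4 u).const_mul (c₁ * c₂)).div_const 2)).add
    (((hasDerivAt_pow 5 u).const_mul (c₂ ^ 2 + 2 * c₁ * c₃)).div_const 5)).add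
    (((hasDerivAt_pow 6 u).const_mul (c₂ * c₃)).div_const 3)).add
    (((hasDerivAt_pow 7 u).const_mul (c₃ ^ 2)).div_const 7)
  exact this.congr_deriv (by norm_num; ring)

/-- Riemann sums of a monotone function, on a grid of step `1 / m`. -/
lemma riemann_sum_bounds {f : ℝ → ℝ} (hf : MonotoneOn f (Set.Icc 0 1)) {m n : ℕ} (hm : 0 < m)
    (hn : n ≤ m) :
    ∑ k ∈ Finset.range n, f (k / m) ≤ m * ∫ y in (0 : ℝ)..(n / m), f y ∧
      m * ∫ y in (0 : ℝ)..(n / m), f y ≤ ∑ k ∈ Finset.range n, f (((k + 1 : ℕ) : ℝ) / m) := by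
  have hm' : (0 : ℝ) < m := by exact_mod_cast hm
  have hn' : (n : ℝ) ≤ m := by exact_mod_cast hn
  have hg : MonotoneOn (fun y => f (y / m)) (Set.Icc (0 : ℝ) (0 + n)) := by
    intro x hx y hy hxy
    have hb : ∀ z ∈ Set.Icc (0 : ℝ) (0 + n), z / m ∈ Set.Icc (0 : ℝ) 1 := fun z hz =>
      ⟨div_nonneg hz.1 hm'.le, (div_le_one hm').2 (by linarith [hz.2])⟩
    exact hf (hb x hx) (hb y hy) (by gcongr)
  have e : ∫ y in (0 : ℝ)..(0 + n), f (y / m) = m * ∫ y in (0 : ℝ)..(n / m), f y := by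
    rw [intervalIntegral.integral_comp_div _ hm'.ne']; simp
  constructor
  · have := hg.sum_le_integral
    rw [e] at this
    simpa using this
  · have := hg.integral_le_sum
    rw [e] at this
    simpa using this

lemma sum_shift_eq (f : ℝ → ℝ) (m n : ℕ) :
    ∑ k ∈ Finset.range n, f (((k + 1 : ℕ) : ℝ) / m) =
      ∑ k ∈ Finset.range n, f ((k : ℝ) / m) + f (n / m) - f 0 := by
  have h := Finset.sum_range_succ (fun k : ℕ => f ((k : ℝ) / m)) n
  rw [Finset.sum_range_succ'] at h
  simp only [Nat.cast_zero, zero_div] at h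
  linarith

/-- A sum over all machines, split into those on which a long job has started and the rest. -/
lemma sum_ite_le {m : ℕ} (i : Fin m) (g : ℕ → ℝ) (c : ℝ) :
    ∑ h : Fin m, (if h ≤ i then g h else c) =
      ∑ k ∈ Finset.range (i + 1), g k + ((m : ℝ) - (i + 1)) * c := by
  have h1 : ∑ h : Fin m, (if h ≤ i then g h else c) =
      ∑ k ∈ Finset.range m, (if k ≤ i then g k else c) :=
    Fin.sum_univ_eq_sum_range (fun k => if k ≤ (i : ℕ) then g k else c) m
  have h2 : (i : ℕ) + 1 ≤ m := i.2
  rw [h1, ← Finset.sum_range_add_sum_Ico _ h2]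
  congr 1
  · exact Finset.sum_congr rfl fun k hk => if_pos (by simpa [Nat.lt_succ_iff] using hk)
  · rw [Finset.sum_congr rfl fun k hk => if_neg (by simp at hk; omega)]
    simp [Nat.cast_sub h2]

lemma sum_sub_sq (s : Finset ℕ) (x : ℝ) (g : ℕ → ℝ) :
    ∑ k ∈ s, (x - g k) ^ 2 = s.card * x ^ 2 - 2 * x * ∑ k ∈ s, g k + ∑ k ∈ s, g k ^ 2 := by
  simp only [sub_sq, Finset.sum_add_distrib, Finset.sum_sub_distrib, Finset.mul_sum,
    Finset.sum_const, nsmul_eq_mul]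

/-- With moments `M₁`, `M₂` of the delays of a fraction `x` of the machines, all of them available
before `y`, the dual bound at `y` is a quadratic inequality, whose square is completed here. The
term with `ε` leaves room for machines that become available only after `y`. -/
lemma dual_quadratic_eq (R ε x p M₁ M₂ y : ℝ) :
    (R - 1 - ε) * ((y - R * p) ^ 2 - R * (x * (y - 1) ^ 2 - 2 * (y - 1) * M₁ + M₂
      + (1 - x) * (y - p) ^ 2) + ε * (1 + p - y) ^ 2) =
    (R * (x + M₁ - x * p) - ε * (1 + p)) ^ 2 -
      (R - 1 - ε) * (R * (x + 2 * M₁ + M₂ - (x + (R - 1)) * p ^ 2) - ε * (1 + p) ^ 2) -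
      ((R - 1 - ε) * y - (R * (x + M₁ - x * p) - ε * (1 + p))) ^ 2 := by
  ring

/-- The Bernstein basis on an interval is nonnegative there; a polynomial inequality follows once
the Bernstein coefficients of the difference are nonnegative. -/
lemma bernstein_basis_nonneg {a b u : ℝ} (n : ℕ) (h₁ : a ≤ u) (h₂ : u ≤ b) (k : ℕ) :
    0 ≤ (u - a) ^ k * (b - u) ^ (n - k) :=
  mul_nonneg (pow_nonneg (sub_nonneg.2 h₁) _) (pow_nonneg (sub_nonneg.2 h₂) _)

/-! ### A uniform lower bound -/

/-- A profile below all delay sequences that respect the ratio `1.3651`. -/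
noncomputable def lowerProfile : ℝ → ℝ := profile 0.27 1.91 (-1.41) 0.57

/-- For a fraction `x = 0.27 + u` of started jobs, delayed according to `lowerProfile`, the dual bound
for `1.3651` fails at the vertex of the quadratic in `dual_quadratic_eq`. The room of `1 / 20000`
absorbs the error of the Riemann sums. -/
lemma lower_disc {u : ℝ} (h0 : 0 ≤ u) (h1 : u ≤ 0.73) :
    (0.3651 : ℝ) * ((0.27 + u) + 2 * cubicInt 1.91 (-1.41) 0.57 u
      + cubicSqInt 1.91 (-1.41) 0.57 u - ((0.27 + u) + 0.3651) * cubic 1.91 (-1.41) 0.57 u ^ 2) + 1 / 20000 ≤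
    1.3651 * ((0.27 + u) + cubicInt 1.91 (-1.41) 0.57 u
      - (0.27 + u) * cubic 1.91 (-1.41) 0.57 u) ^ 2 := by
  unfold cubic cubicInt cubicSqInt
  rcases le_total u 0.365 with h | h
  · have H := bernstein_basis_nonneg 9 h0 h
    linarith [H 0, H 1, H 2, H 3, H 4, H 5, H 6, H 7, H 8, H 9]
  · have H := bernstein_basis_nonneg 9 h h1
    linarith [H 0, H 1, H 2, H 3, H 4, H 5, H 6, H 7, H 8, H 9]

/-- The vertex of the quadratic polynomial is an admissible multiplier. -/
lemma lower_vertex_ge {u : ℝ} (h0 : 0 ≤ u) (h1 : u ≤ 0.73) :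
    (0.3651 : ℝ) * cubic 1.91 (-1.41) 0.57 u ≤ (0.27 + u) + cubicInt 1.91 (-1.41) 0.57 u
      - (0.27 + u) * cubic 1.91 (-1.41) 0.57 u := by
  unfold cubic cubicInt
  have H := bernstein_basis_nonneg 5 h0 h1
  linarith [H 0, H 1, H 2, H 3, H 4, H 5]

/-- The vertex is at most `3`, which bounds the factor by which the errors of the Riemann sums enter. -/
lemma lower_vertex_le {u : ℝ} (h0 : 0 ≤ u) (h1 : u ≤ 0.73) :
    (1.3651 : ℝ) * ((0.27 + u) + cubicInt 1.91 (-1.41) 0.57 u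
      - (0.27 + u) * cubic 1.91 (-1.41) 0.57 u) ≤ 3 * 0.3651 := by
  unfold cubic cubicInt
  have H := bernstein_basis_nonneg 5 h0 h1
  linarith [H 0, H 1, H 2, H 3, H 4, H 5]

lemma lower_cubic_monotoneOn : MonotoneOn (cubic 1.91 (-1.41) 0.57) (Set.Icc 0 (1 - 0.27)) :=
  cubic_monotoneOn fun u _ => by nlinarith [sq_nonneg (u - 0.82)]

lemma lowerProfile_monotoneOn : MonotoneOn lowerProfile (Set.Iic 1) :=
  profile_monotoneOn (by norm_num) lower_cubic_monotoneOn

lemma lowerProfile_zero : lowerProfile 0 = 0 := profile_of_le (by norm_num)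

lemma lowerProfile_nonneg {x : ℝ} (h₀ : 0 ≤ x) (h₁ : x ≤ 1) : 0 ≤ lowerProfile x := by
  rw [← lowerProfile_zero]
  exact lowerProfile_monotoneOn (by norm_num) h₁ h₀

lemma lowerProfile_le_one {x : ℝ} (h₁ : x ≤ 1) : lowerProfile x ≤ 1 := by
  refine (lowerProfile_monotoneOn h₁ (Set.mem_Iic.2 le_rfl) h₁).trans ?_
  rw [lowerProfile, profile_of_ge (by norm_num), cubic]; norm_num

/-- If the first jobs are delayed at least as much as the profile prescribes, then the next job
cannot start earlier than the profile prescribes: the multiplier at the vertex of the quadratic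
function in `lower_disc` violates the dual bound. -/
lemma not_dualBound_lowerProfile {m : ℕ} (hm : 1000000 ≤ m) (i : Fin m)
    (hx : (0.27 : ℝ) ≤ ((i + 1 : ℕ) : ℝ) / m) :
    ¬ DualBound 1.3651 (lowerProfile (((i + 1 : ℕ) : ℝ) / m)) (fun h : Fin m =>
      if h ≤ i then 1 + lowerProfile ((h : ℕ) / m) else lowerProfile (((i + 1 : ℕ) : ℝ) / m)) := by
  intro H
  have hm0 : 0 < m := by omega
  have hm' : (0 : ℝ) < m := by exact_mod_cast hm0
  have hmR : (1000000 : ℝ) ≤ m := by exact_mod_cast hm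
  have hi : (i : ℕ) + 1 ≤ m := i.2
  have hsub : Set.Icc (0 : ℝ) 1 ⊆ Set.Iic 1 := fun y hy => hy.2
  have b1 := riemann_sum_bounds (lowerProfile_monotoneOn.mono hsub) hm0 hi
  have b2 := riemann_sum_bounds (f := fun y => lowerProfile y ^ 2)
    (fun y hy z hz hyz => pow_le_pow_left₀ (lowerProfile_nonneg hy.1 hy.2)
      (lowerProfile_monotoneOn hy.2 hz.2 hyz) 2) hm0 hi
  rw [sum_shift_eq, lowerProfile_zero] at b1
  have hx1 : ((i + 1 : ℕ) : ℝ) / m ≤ 1 := (div_le_one hm').2 (by exact_mod_cast hi)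
  have hmx : (i : ℝ) + 1 = m * (((i + 1 : ℕ) : ℝ) / m) := by
    push_cast; field_simp
  have hp0 := lowerProfile_nonneg (by linarith) hx1
  have hp1 := lowerProfile_le_one hx1
  have hI1 : ∫ y in (0 : ℝ)..(((i + 1 : ℕ) : ℝ) / m), lowerProfile y = _ :=
    integral_profile (by norm_num) hx
  have hI2 : ∫ y in (0 : ℝ)..(((i + 1 : ℕ) : ℝ) / m), lowerProfile y ^ 2 = _ :=
    integral_profile_sq (by norm_num) hx
  have hp : lowerProfile (((i + 1 : ℕ) : ℝ) / m) = _ := profile_of_ge hx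
  rw [hI1] at b1
  rw [hI2] at b2
  set x : ℝ := ((i + 1 : ℕ) : ℝ) / m
  set p := lowerProfile x
  have d1 := lower_disc (u := x - 0.27) (by linarith) (by linarith)
  have d2 := lower_vertex_ge (u := x - 0.27) (by linarith) (by linarith)
  have d3 := lower_vertex_le (u := x - 0.27) (by linarith) (by linarith)
  rw [← hp, add_sub_cancel] at d1 d2 d3
  set M₁ := cubicInt 1.91 (-1.41) 0.57 (x - 0.27)
  set M₂ := cubicSqInt 1.91 (-1.41) 0.57 (x - 0.27)
  set S₁ := ∑ k ∈ Finset.range (i + 1), lowerProfile (k / m)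
  set S₂ := ∑ k ∈ Finset.range (i + 1), lowerProfile (k / m) ^ 2
  set V := x + M₁ - x * p
  -- the vertex of the quadratic
  obtain ⟨y, hy⟩ : ∃ y : ℝ, 0.3651 * y = 1.3651 * V := ⟨1.3651 * V / 0.3651, by ring⟩
  have hV : 1.3651 * p ≤ y := by linarith
  have hy3 : y ≤ 3 := by linarith
  have h1 := H y hV
  have h2 : ∑ h : Fin m, (max (y - if h ≤ i then 1 + lowerProfile ((h : ℕ) / m) else p) 0) ^ 2 ≤
      ∑ h : Fin m, if h ≤ i then (y - 1 - lowerProfile ((h : ℕ) / m)) ^ 2 else (y - p) ^ 2 := by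
    refine Finset.sum_le_sum fun h _ => ?_
    have key : ∀ z : ℝ, (max z 0) ^ 2 ≤ z ^ 2 := fun z => by
      rcases le_total z 0 with h | h
      · rw [max_eq_right h]; simpa using sq_nonneg z
      · rw [max_eq_left h]
    split_ifs
    · rw [sub_sub]; exact key _
    · exact key _
  rw [sum_ite_le i (fun k => (y - 1 - lowerProfile (k / m)) ^ 2) ((y - p) ^ 2), sum_sub_sq,
    Finset.card_range] at h2
  push_cast at h2
  rw [hmx] at h2
  have h3 : -2 * (y - 1) * S₁ ≤ -2 * (y - 1) * (m * M₁) + 4 := by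
    have e1 : 0 ≤ m * M₁ - S₁ := by linarith [b1.1]
    have e2 : m * M₁ - S₁ ≤ 1 := by linarith [b1.2]
    linarith [mul_nonneg e1 (sub_nonneg.2 hy3)]
  have h4 : (m : ℝ) * (y - 1.3651 * p) ^ 2 ≤ 1.3651 * (m * (x * (y - 1) ^ 2 - 2 * (y - 1) * M₁ + M₂
      + (1 - x) * (y - p) ^ 2) + 4) := by
    have := b2.1
    linarith
  have h5 : (0.3651 : ℝ) * ((y - 1.3651 * p) ^ 2 - 1.3651 * (x * (y - 1) ^ 2 - 2 * (y - 1) * M₁ + M₂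
      + (1 - x) * (y - p) ^ 2)) = 1.3651 * (1.3651 * V ^ 2 -
        0.3651 * (x + 2 * M₁ + M₂ - (x + 0.3651) * p ^ 2)) := by
    have e := dual_quadratic_eq 1.3651 0 x p M₁ M₂ y
    have e' : ((1.3651 : ℝ) - 1 - 0) * y - (1.3651 * (x + M₁ - x * p) - 0 * (1 + p)) = 0 := by
      linarith
    rw [e'] at e
    linarith
  have h6 : (m : ℝ) * ((y - 1.3651 * p) ^ 2 - 1.3651 * (x * (y - 1) ^ 2 - 2 * (y - 1) * M₁ + M₂
      + (1 - x) * (y - p) ^ 2)) ≤ 1.3651 * 4 := by linarith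
  set q := (y - 1.3651 * p) ^ 2 - 1.3651 * (x * (y - 1) ^ 2 - 2 * (y - 1) * M₁ + M₂
      + (1 - x) * (y - p) ^ 2)
  have h7 : (1 : ℝ) / 20000 ≤ q := by linarith
  have h8 := mul_le_mul hmR h7 (by norm_num) hm'.le
  linarith

/-- For large `m`, delay sequences that respect `1.3651` would lie above `lowerProfile`, whose
integral exceeds `0.3651`. -/
lemma lower_lt_of_dualFeasible {m : ℕ} (hm : 1000000 ≤ m) {t : Fin m → ℝ} {R : ℝ}
    (H : DualFeasible t R) : 1.3651 < R := by
  by_contra! hR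
  replace H := H.mono_ratio hR
  have hm0 : 0 < m := by omega
  have hm' : (0 : ℝ) < m := by exact_mod_cast hm0
  have key : ∀ n : ℕ, ∀ hn : n < m, lowerProfile (((n + 1 : ℕ) : ℝ) / m) ≤ t ⟨n, hn⟩ := by
    intro n
    induction n using Nat.strong_induction_on with
    | _ n ih =>
      intro hn
      by_contra! hlt
      have hx : (0.27 : ℝ) ≤ ((n + 1 : ℕ) : ℝ) / m := by
        by_contra! hx
        rw [lowerProfile, profile_of_le hx.le] at hlt
        exact absurd (H.nonneg ⟨n, hn⟩) (not_le.2 hlt)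
      refine not_dualBound_lowerProfile hm ⟨n, hn⟩ hx ?_
      have h1 := (H.dual ⟨n, hn⟩).shift (by norm_num) (sub_nonneg.2 hlt.le)
      rw [add_sub_cancel] at h1
      refine h1.mono (by norm_num) fun h => ?_
      have h2 : lowerProfile ((h : ℕ) / m) ≤ t h ∨ ⟨n, hn⟩ < h := by
        rcases lt_or_ge ⟨n, hn⟩ h with h' | h'
        · exact Or.inr h'
        left
        obtain ⟨h, hh⟩ := h
        rcases h with _ | k
        · simpa [lowerProfile_zero] using H.nonneg _
        · exact (ih k (by simpa using h') (by omega)).trans (H.mono (by simp))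
      unfold availability
      split_ifs with h'
      · rcases h2 with h2 | h2
        · linarith [le_max_left (t h + 1) (t ⟨n, hn⟩)]
        · exact absurd h' (not_le.2 h2)
      · linarith
  have h1 : ∑ k ∈ Finset.range m, lowerProfile (((k + 1 : ℕ) : ℝ) / m) ≤ ∑ i, t i := by
    rw [← Fin.sum_univ_eq_sum_range (fun k => lowerProfile (((k + 1 : ℕ) : ℝ) / m))]
    exact Finset.sum_le_sum fun i _ => key i i.2
  have h2 := (riemann_sum_bounds (lowerProfile_monotoneOn.mono fun y hy => hy.2) hm0 le_rfl).2
  have hI : ∫ y in (0 : ℝ)..1, lowerProfile y = _ := integral_profile (by norm_num) (by norm_num)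
  rw [div_self hm'.ne', hI, cubicInt] at h2
  have h3 := H.sum_le
  nlinarith

/-! ### A uniform upper bound -/

/-- By Minkowski's inequality, the dual bound at `y` implies the one at `x ≤ y`, as long as few
machines become available before `y`. -/
lemma dual_at_of_le {m : ℕ} {R r x y : ℝ} {a : Fin m → ℝ} (hR : 0 ≤ R) (hx : R * r ≤ x)
    (hxy : x ≤ y) (hact : R * (Finset.univ.filter fun h => a h < y).card ≤ m)
    (H : (m : ℝ) * (y - R * r) ^ 2 ≤ R * ∑ h, (max (y - a h) 0) ^ 2) :
    (m : ℝ) * (x - R * r) ^ 2 ≤ R * ∑ h, (max (x - a h) 0) ^ 2 := by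
  set s := Finset.univ.filter fun h => a h < y
  have hs : ∀ z ≤ y, ∑ h, (max (z - a h) 0) ^ 2 = ∑ h ∈ s, (max (z - a h) 0) ^ 2 := by
    intro z hz
    refine (Finset.sum_subset (Finset.subset_univ s) fun h _ hh => ?_).symm
    have : y ≤ a h := by simpa [s] using hh
    rw [max_eq_right (by linarith)]; norm_num
  rw [hs y le_rfl] at H
  rw [hs x hxy]
  set w : Fin m → ℝ := fun h => max (x - a h) 0
  set δ := y - x
  have hδ : 0 ≤ δ := sub_nonneg.2 hxy
  have h1 : ∑ h ∈ s, (max (y - a h) 0) ^ 2 ≤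
      ∑ h ∈ s, w h ^ 2 + 2 * δ * ∑ h ∈ s, w h + δ ^ 2 * s.card := by
    calc ∑ h ∈ s, (max (y - a h) 0) ^ 2 ≤ ∑ h ∈ s, (w h + δ) ^ 2 :=
          Finset.sum_le_sum fun h _ => pow_le_pow_left₀ (le_max_right _ _)
            (max_le (by simp only [δ]; linarith [le_max_left (x - a h) 0])
              (add_nonneg (le_max_right _ _) hδ)) 2
      _ = _ := by
        simp only [add_sq, Finset.sum_add_distrib, Finset.sum_const, nsmul_eq_mul,
          Finset.mul_sum]
        congr 1
        · congr 1
          exact Finset.sum_congr rfl fun h _ => by ring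
        · ring
  have h2 : (∑ h ∈ s, w h) ^ 2 ≤ (s.card : ℝ) * ∑ h ∈ s, w h ^ 2 := sq_sum_le_card_mul_sum_sq
  set W := ∑ h ∈ s, w h
  set n := ∑ h ∈ s, w h ^ 2
  set c : ℝ := (s.card : ℝ)
  by_contra! hlt
  set l := x - R * r
  have hl : 0 ≤ l := sub_nonneg.2 hx
  have hn : 0 ≤ n := Finset.sum_nonneg fun _ _ => sq_nonneg _
  have hm0 : (0 : ℝ) ≤ m := Nat.cast_nonneg m
  have h3 : (R * W) ^ 2 ≤ (m * l) ^ 2 := by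
    calc (R * W) ^ 2 = R ^ 2 * W ^ 2 := by ring
      _ ≤ R ^ 2 * (c * n) := by gcongr
      _ = (R * c) * (R * n) := by ring
      _ ≤ m * (m * l ^ 2) := mul_le_mul hact hlt.le (by positivity) hm0
      _ = _ := by ring
  have h4 : R * W ≤ m * l := le_of_sq_le_sq h3 (by positivity)
  have h5 := mul_le_mul_of_nonneg_left h1 hR
  have h6 : y - R * r = l + δ := by simp only [l, δ]; ring
  rw [h6] at H
  have h7 := mul_le_mul_of_nonneg_left h4 hδ
  have h8 := mul_le_mul_of_nonneg_left hact (sq_nonneg δ)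
  linarith

/-- Comparison of a sum of squares on a grid with the integral, a third of a cube. -/
lemma sum_posPart_sq_le {z c : ℝ} (hz : 0 ≤ z) (hc : 0 ≤ c) (n : ℕ) :
    c * ∑ k ∈ Finset.range n, (max (z - c * k) 0) ^ 2 ≤ c * z ^ 2 + z ^ 3 / 3 := by
  have key : ∀ n : ℕ, c * ∑ k ∈ Finset.range (n + 1), (max (z - c * k) 0) ^ 2 ≤
      c * z ^ 2 + (z ^ 3 - (max (z - c * n) 0) ^ 3) / 3 := by
    intro n
    induction n with
    | zero => simp [hz]
    | succ n ih =>
      rw [Finset.sum_range_succ, mul_add]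
      have h1 : c * (max (z - c * ((n + 1 : ℕ) : ℝ)) 0) ^ 2 ≤
          ((max (z - c * n) 0) ^ 3 - (max (z - c * ((n + 1 : ℕ) : ℝ)) 0) ^ 3) / 3 := by
        push_cast
        rcases le_total (z - c * (n + 1)) 0 with h | h
        · rw [max_eq_right h]
          have : 0 ≤ (max (z - c * n) 0) ^ 3 := pow_nonneg (le_max_right _ _) 3
          norm_num; linarith
        · rw [max_eq_left h, max_eq_left (by linarith)]
          have e : z - c * n = z - c * (n + 1) + c := by ring
          rw [e]
          set b := z - c * (n + 1)
          have : 0 ≤ b * c ^ 2 := by positivity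
          have : 0 ≤ c ^ 3 := by positivity
          linarith [show (b + c) ^ 3 - b ^ 3 = 3 * (c * b ^ 2) + 3 * (b * c ^ 2) + c ^ 3 by ring]
      linarith
  rcases n with _ | n
  · simp; positivity
  · have : 0 ≤ (max (z - c * n) 0) ^ 3 := pow_nonneg (le_max_right _ _) 3
    linarith [key n]

/-- A profile that, slightly rounded, respects the ratio `1.367` for a large number of machines. -/
noncomputable def upperProfile : ℝ → ℝ := profile 0.268 1.87 (-1.285) 0.47

/-- The discriminant condition for `1.367` and `upperProfile` at the fraction `x = 0.268 + u`. The terms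
with `0.15` account for the machines of `upper_tail_le`, so the leading coefficient `0.367` drops to
`0.217`, and the room of `1 / 100000` absorbs the error of the Riemann sums. -/
lemma upper_disc {u : ℝ} (h0 : 0 ≤ u) (h1 : u ≤ 0.732) :
    (1.367 * ((0.268 + u) + cubicInt 1.87 (-1.285) 0.47 u
        - (0.268 + u) * cubic 1.87 (-1.285) 0.47 u)
      - 0.15 * (1 + cubic 1.87 (-1.285) 0.47 u)) ^ 2 + 1 / 100000 ≤
    0.217 * (1.367 * ((0.268 + u) + 2 * cubicInt 1.87 (-1.285) 0.47 u
        + cubicSqInt 1.87 (-1.285) 0.47 u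
        - ((0.268 + u) + 0.367) * cubic 1.87 (-1.285) 0.47 u ^ 2)
      - 0.15 * (1 + cubic 1.87 (-1.285) 0.47 u) ^ 2) := by
  unfold cubic cubicInt cubicSqInt
  rcases le_total u 0.366 with h | h
  · rcases le_total u 0.183 with h' | h'
    · have H := bernstein_basis_nonneg 9 h0 h'
      linarith [H 0, H 1, H 2, H 3, H 4, H 5, H 6, H 7, H 8, H 9]
    · have H := bernstein_basis_nonneg 9 h' h
      linarith [H 0, H 1, H 2, H 3, H 4, H 5, H 6, H 7, H 8, H 9]
  · have H := bernstein_basis_nonneg 9 h h1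
    linarith [H 0, H 1, H 2, H 3, H 4, H 5, H 6, H 7, H 8, H 9]

lemma upper_cubic_monotoneOn : MonotoneOn (cubic 1.87 (-1.285) 0.47) (Set.Icc 0 (1 - 0.268)) :=
  cubic_monotoneOn fun u hu => by nlinarith [sq_nonneg (u - 0.82), hu.1, hu.2]

/-- The waiting times after the threshold `y` of `upper_tail_le`, at most the increase of the profile
over the last fraction `367 / 1367` of machines, are small compared to its slope at the end. This is
the case where the increase starts from the flat part. -/
lemma upper_band_start {u : ℝ} (h0 : 0 ≤ u) (h1 : u ≤ 367 / 1367) :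
    1.367 * cubic 1.87 (-1.285) 0.47 u ≤ 0.447 * (1.87 - 2.57 * u + 1.41 * u ^ 2) := by
  unfold cubic
  have H := bernstein_basis_nonneg 4 h0 h1
  linarith [H 0, H 1, H 2, H 3, H 4]

/-- As `upper_band_start`, with the increase lying within the cubic part. -/
lemma upper_band {u : ℝ} (h0 : 367 / 1367 ≤ u) (h1 : u ≤ 0.732) :
    1.367 * (cubic 1.87 (-1.285) 0.47 u - cubic 1.87 (-1.285) 0.47 (u - 367 / 1367)) ≤
      0.447 * (1.87 - 2.57 * u + 1.41 * u ^ 2) := by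
  unfold cubic
  have H := bernstein_basis_nonneg 4 h0 h1
  linarith [H 0, H 1, H 2, H 3, H 4]

lemma upperProfile_monotoneOn : MonotoneOn upperProfile (Set.Iic 1) :=
  profile_monotoneOn (by norm_num) upper_cubic_monotoneOn

lemma upperProfile_zero : upperProfile 0 = 0 := profile_of_le (by norm_num)

lemma upperProfile_nonneg {x : ℝ} (h₁ : x ≤ 1) : 0 ≤ upperProfile x := by
  rcases le_total x 0 with h | h
  · exact (profile_of_le (by linarith)).ge
  · rw [← upperProfile_zero]
    exact upperProfile_monotoneOn (by norm_num) h₁ h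

lemma upperProfile_le_one {x : ℝ} (h₁ : x ≤ 1) : upperProfile x ≤ 1 := by
  refine (upperProfile_monotoneOn h₁ (Set.mem_Iic.2 le_rfl) h₁).trans ?_
  rw [upperProfile, profile_of_ge (by norm_num), cubic]; norm_num

lemma upper_cubic_tangent {u v : ℝ} (hv : v ≤ u) (hu : u ≤ 0.732) :
    cubic 1.87 (-1.285) 0.47 v ≤
      cubic 1.87 (-1.285) 0.47 u - (1.87 - 2.57 * u + 1.41 * u ^ 2) * (u - v) := by
  have h : 0 ≤ (u - v) ^ 2 * (1.285 - 0.47 * (2 * u + v)) :=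
    mul_nonneg (sq_nonneg _) (by linarith)
  unfold cubic
  linarith

/-- The squared waiting times of the machines that become available only after `y`. The profile
lies below its tangent, of slope `l` at the end, so waiting times up to `w` contribute about
`m w ^ 3 / (3 l)`, and `1.367 * w ≤ 0.447 * l` makes this `0.149 * m * w ^ 2` after multiplication by
`1.367`. The fraction `367 / 1367` is `1 - 1 / 1.367`: up to this `y` at most `m / 1.367` machines are
available, as `dual_at_of_le` requires. -/
lemma upper_tail_le {m : ℕ} (hm : 1000000 ≤ m) {n : ℕ} (hn : n + 1 ≤ m) {y : ℝ}
    (hx : (0.268 : ℝ) ≤ ((n + 1 : ℕ) : ℝ) / m)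
    (hy : 1 + upperProfile (((n + 1 : ℕ) : ℝ) / m - 367 / 1367) ≤ y) :
    1.367 * ∑ k ∈ Finset.range (n + 1), (max (1 + upperProfile (((k + 1 : ℕ) : ℝ) / m) - y) 0) ^ 2 ≤
      0.15 * m * (1 + upperProfile (((n + 1 : ℕ) : ℝ) / m) - y) ^ 2 := by
  have hm0 : 0 < m := by omega
  have hm' : (0 : ℝ) < m := by exact_mod_cast hm0
  have hmR : (1000000 : ℝ) ≤ m := by exact_mod_cast hm
  have hx1 : ((n + 1 : ℕ) : ℝ) / m ≤ 1 := (div_le_one hm').2 (by exact_mod_cast hn)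
  set x : ℝ := ((n + 1 : ℕ) : ℝ) / m with hxdef
  have hp : upperProfile x = _ := profile_of_ge hx
  have hy1 : 1 ≤ y := by linarith [upperProfile_nonneg (x := x - 367 / 1367) (by linarith)]
  set u := x - 0.268 with hu
  set l := 1.87 - 2.57 * u + 1.41 * u ^ 2 with hldef
  have hl : 0 < l := by rw [hldef]; nlinarith [sq_nonneg (u - 0.91)]
  have hz : 1.367 * (upperProfile x - upperProfile (x - 367 / 1367)) ≤ 0.447 * l := by
    rcases le_total (x - 367 / 1367) 0.268 with h | h
    · rw [hp, upperProfile, profile_of_le h, sub_zero]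
      exact upper_band_start (by linarith) (by linarith)
    · rw [hp, upperProfile, profile_of_ge h, sub_right_comm]
      exact upper_band (by linarith) (by linarith)
  set z := 1 + upperProfile x - y with hzdef
  set w := max z 0
  have hw : 0 ≤ w := le_max_right _ _
  have hwl : 1.367 * w ≤ 0.447 * l := by
    rcases le_total z 0 with h | h
    · simp only [w]; rw [max_eq_right h]; linarith
    · simp only [w]; rw [max_eq_left h]; linarith
  have h1 : ∀ k ∈ Finset.range (n + 1), (max (1 + upperProfile (((k + 1 : ℕ) : ℝ) / m) - y) 0) ^ 2 ≤
      (max (w - l / m * ((n + 1 - 1 - k : ℕ) : ℝ)) 0) ^ 2 := by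
    intro k hk
    have hk' : k ≤ n := by simpa [Nat.lt_succ_iff] using hk
    rcases le_total (((k + 1 : ℕ) : ℝ) / m) 0.268 with h | h
    · rw [upperProfile, profile_of_le h, max_eq_right (by linarith)]
      simp
    · apply posPart_sq_mono
      have h2 : ((k + 1 : ℕ) : ℝ) / m ≤ x := by
        rw [hxdef]; gcongr
      have h3 := upper_cubic_tangent (u := u) (v := ((k + 1 : ℕ) : ℝ) / m - 0.268)
        (by linarith) (by linarith)
      have h4 : l / m * ((n + 1 - 1 - k : ℕ) : ℝ) = l * (u - (((k + 1 : ℕ) : ℝ) / m - 0.268)) := by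
        rw [Nat.add_sub_cancel, Nat.cast_sub hk']
        rw [hu, hxdef]; push_cast; field_simp; ring
      rw [h4, upperProfile, profile_of_ge h]
      rw [← hldef] at h3
      have h5 : z ≤ w := le_max_left z 0
      linarith
  have h2 := Finset.sum_le_sum h1
  rw [Finset.sum_range_reflect (fun k : ℕ => (max (w - l / m * (k : ℝ)) 0) ^ 2) (n + 1)] at h2
  have h3 := sum_posPart_sq_le hw (by positivity : 0 ≤ l / m) (n + 1)
  set E := ∑ k ∈ Finset.range (n + 1), (max (1 + upperProfile (((k + 1 : ℕ) : ℝ) / m) - y) 0) ^ 2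
  have h4 : l * E ≤ l * w ^ 2 + m * w ^ 3 / 3 := by
    have h5 := (mul_le_mul_of_nonneg_left h2 (by positivity : 0 ≤ l / m)).trans h3
    have h6 := mul_le_mul_of_nonneg_left h5 hm'.le
    calc l * E = m * (l / m * E) := by field_simp
      _ ≤ _ := h6
      _ = _ := by field_simp
  have h5 : l * (1.367 * E) ≤ l * (0.15 * m * w ^ 2) := by
    have h6 := mul_le_mul_of_nonneg_left hwl (by positivity : 0 ≤ m * w ^ 2 / 3)
    have h7 := mul_le_mul_of_nonneg_right hmR (by positivity : 0 ≤ l * w ^ 2)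
    have h8 : 0 ≤ l * w ^ 2 := by positivity
    clear_value l w E
    linarith
  have h6 : w ^ 2 ≤ z ^ 2 := by
    rcases le_total z 0 with h | h
    · simp only [w]; rw [max_eq_right h]; simpa using sq_nonneg z
    · simp only [w]; rw [max_eq_left h]
  calc 1.367 * E ≤ 0.15 * m * w ^ 2 := le_of_mul_le_mul_left h5 hl
    _ ≤ _ := by gcongr

lemma posPart_sq_eq (z : ℝ) : (max z 0) ^ 2 = z ^ 2 - (max (-z) 0) ^ 2 := by
  rcases le_total z 0 with h | h
  · rw [max_eq_right h, max_eq_left (by linarith)]; ring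
  · rw [max_eq_left h, max_eq_right (by linarith)]; ring

/-- The dual bound for the upper profile at multipliers `y` that leave only few machines
unavailable. -/
lemma upper_dual_of_ge {m : ℕ} (hm : 1000000 ≤ m) (i : Fin m) {y : ℝ}
    (hx : (0.268 : ℝ) ≤ ((i + 1 : ℕ) : ℝ) / m)
    (hy : 1 + upperProfile (((i + 1 : ℕ) : ℝ) / m - 367 / 1367) ≤ y) (hy14 : y ≤ 14)
    (hyp : upperProfile (((i + 1 : ℕ) : ℝ) / m) ≤ y) :
    (m : ℝ) * (y - 1.367 * upperProfile (((i + 1 : ℕ) : ℝ) / m)) ^ 2 ≤ 1.367 * ∑ h : Fin m,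
      (max (y - if h ≤ i then 1 + upperProfile (((h + 1 : ℕ) : ℝ) / m)
        else upperProfile (((i + 1 : ℕ) : ℝ) / m)) 0) ^ 2 := by
  have hm0 : 0 < m := by omega
  have hm' : (0 : ℝ) < m := by exact_mod_cast hm0
  have hmR : (1000000 : ℝ) ≤ m := by exact_mod_cast hm
  have hi : (i : ℕ) + 1 ≤ m := i.2
  have tail := upper_tail_le hm hi hx hy
  have hsub : Set.Icc (0 : ℝ) 1 ⊆ Set.Iic 1 := fun y hy => hy.2
  have b1 := riemann_sum_bounds (upperProfile_monotoneOn.mono hsub) hm0 hi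
  have b1' := sum_shift_eq upperProfile m (i + 1)
  have b2 := (riemann_sum_bounds (f := fun y => upperProfile y ^ 2)
    (fun y hy z hz hyz => pow_le_pow_left₀ (upperProfile_nonneg hy.2)
      (upperProfile_monotoneOn hy.2 hz.2 hyz) 2) hm0 hi).2
  rw [upperProfile_zero] at b1'
  have hx1 : ((i + 1 : ℕ) : ℝ) / m ≤ 1 := (div_le_one hm').2 (by exact_mod_cast hi)
  have hmx : (i : ℝ) + 1 = m * (((i + 1 : ℕ) : ℝ) / m) := by
    push_cast; field_simp
  have hp1 := upperProfile_le_one hx1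
  have hI1 : ∫ y in (0 : ℝ)..(((i + 1 : ℕ) : ℝ) / m), upperProfile y = _ :=
    integral_profile (by norm_num) hx
  have hI2 : ∫ y in (0 : ℝ)..(((i + 1 : ℕ) : ℝ) / m), upperProfile y ^ 2 = _ :=
    integral_profile_sq (by norm_num) hx
  have hp : upperProfile (((i + 1 : ℕ) : ℝ) / m) = _ := profile_of_ge hx
  rw [hI1] at b1
  rw [hI2] at b2
  have hy1 : 1 ≤ y := by
    linarith [upperProfile_nonneg (x := ((i + 1 : ℕ) : ℝ) / m - 367 / 1367) (by linarith)]
  set x : ℝ := ((i + 1 : ℕ) : ℝ) / m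
  set p := upperProfile x
  have d1 := upper_disc (u := x - 0.268) (by linarith) (by linarith)
  rw [← hp, add_sub_cancel] at d1
  set M₁ := cubicInt 1.87 (-1.285) 0.47 (x - 0.268)
  set M₂ := cubicSqInt 1.87 (-1.285) 0.47 (x - 0.268)
  have h1 : ∀ h : Fin m, (max (y - if h ≤ i then 1 + upperProfile (((h + 1 : ℕ) : ℝ) / m)
        else p) 0) ^ 2 = if h ≤ i then (y - 1 - upperProfile (((h + 1 : ℕ) : ℝ) / m)) ^ 2 -
          (max (1 + upperProfile (((h + 1 : ℕ) : ℝ) / m) - y) 0) ^ 2 else (y - p) ^ 2 := by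
    intro h
    split_ifs
    · rw [posPart_sq_eq, neg_sub, sub_sub]
    · rw [max_eq_left (by linarith)]
  rw [Finset.sum_congr rfl fun h _ => h1 h,
    sum_ite_le i (fun k => (y - 1 - upperProfile (((k + 1 : ℕ) : ℝ) / m)) ^ 2 -
      (max (1 + upperProfile (((k + 1 : ℕ) : ℝ) / m) - y) 0) ^ 2) ((y - p) ^ 2),
    Finset.sum_sub_distrib, sum_sub_sq, Finset.card_range, Nat.cast_add_one, hmx]
  set S₁ := ∑ k ∈ Finset.range (i + 1), upperProfile (((k + 1 : ℕ) : ℝ) / m)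
  set S₂ := ∑ k ∈ Finset.range (i + 1), upperProfile (((k + 1 : ℕ) : ℝ) / m) ^ 2
  set E := ∑ k ∈ Finset.range (i + 1), (max (1 + upperProfile (((k + 1 : ℕ) : ℝ) / m) - y) 0) ^ 2
  have h2 : 2 * (y - 1) * S₁ ≤ 2 * (y - 1) * (m * M₁) + 26 := by
    have e1 : S₁ - m * M₁ ≤ 1 := by linarith [b1.1]
    have e2 := mul_le_mul_of_nonneg_left e1 (sub_nonneg.2 hy1)
    linarith
  have e := dual_quadratic_eq 1.367 0.15 x p M₁ M₂ y
  set q := (y - 1.367 * p) ^ 2 - 1.367 * (x * (y - 1) ^ 2 - 2 * (y - 1) * M₁ + M₂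
      + (1 - x) * (y - p) ^ 2) + 0.15 * (1 + p - y) ^ 2 with hq
  have h3 : q ≤ -(1 / 21700) := by
    have := sq_nonneg ((1.367 - 1 - 0.15) * y - (1.367 * (x + M₁ - x * p) - 0.15 * (1 + p)))
    linarith
  have h4 : m * q ≤ m * -(1 / 21700) := by gcongr
  have h5 : m * q = m * (y - 1.367 * p) ^ 2 - 1.367 * (m * x * (y - 1) ^ 2
      - 2 * (y - 1) * (m * M₁) + m * M₂ + (m - m * x) * (y - p) ^ 2)
      + 0.15 * m * (1 + p - y) ^ 2 := by
    rw [hq]; ring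
  linarith

/-- The dual bound for the upper profile. If at most a fraction `1 - 1 / 1.367` of the jobs has started,
then the machines without a long job suffice. -/
lemma upper_dual {m : ℕ} (hm : 1000000 ≤ m) (i : Fin m) :
    DualBound 1.367 (upperProfile (((i + 1 : ℕ) : ℝ) / m)) (fun h : Fin m =>
      if h ≤ i then 1 + upperProfile (((h + 1 : ℕ) : ℝ) / m)
        else upperProfile (((i + 1 : ℕ) : ℝ) / m)) := by
  have hm0 : 0 < m := by omega
  have hm' : (0 : ℝ) < m := by exact_mod_cast hm0
  have hi : (i : ℕ) + 1 ≤ m := i.2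
  have hx1 : ((i + 1 : ℕ) : ℝ) / m ≤ 1 := (div_le_one hm').2 (by exact_mod_cast hi)
  have hmx : (i : ℝ) + 1 = m * (((i + 1 : ℕ) : ℝ) / m) := by
    push_cast; field_simp
  have hp0 := upperProfile_nonneg hx1
  have hp1 := upperProfile_le_one hx1
  intro y hy
  rcases le_total (((i + 1 : ℕ) : ℝ) / m) (367 / 1367) with hx | hx
  · -- enough machines are free
    have h1 : ∑ h : Fin m, (if h ≤ i then 0 else (y - upperProfile (((i + 1 : ℕ) : ℝ) / m)) ^ 2) ≤
        ∑ h : Fin m, (max (y - if h ≤ i then 1 + upperProfile (((h + 1 : ℕ) : ℝ) / m)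
        else upperProfile (((i + 1 : ℕ) : ℝ) / m)) 0) ^ 2 := by
      refine Finset.sum_le_sum fun h _ => ?_
      split_ifs
      · positivity
      · exact pow_le_pow_left₀ (by linarith) (le_max_left _ _) 2
    rw [sum_ite_le i (fun _ => 0), Finset.sum_const_zero, zero_add, hmx] at h1
    have h2 : (y - 1.367 * upperProfile (((i + 1 : ℕ) : ℝ) / m)) ^ 2 ≤
        (y - upperProfile (((i + 1 : ℕ) : ℝ) / m)) ^ 2 :=
      pow_le_pow_left₀ (by linarith) (by linarith) 2
    refine le_trans ?_ (mul_le_mul_of_nonneg_left h1 (by norm_num))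
    set x : ℝ := ((i + 1 : ℕ) : ℝ) / m
    have h3 : (1 : ℝ) ≤ 1.367 * (1 - x) := by linarith
    have h4 := mul_le_mul_of_nonneg_left h2 hm'.le
    have h5 := mul_le_mul_of_nonneg_right h3
      (by positivity : 0 ≤ m * (y - upperProfile x) ^ 2)
    linarith
  rcases le_total 14 y with hy14 | hy14
  · -- all machines are available long before `y`
    have h1 : ∑ h : Fin m, (y - 2) ^ 2 ≤
        ∑ h : Fin m, (max (y - if h ≤ i then 1 + upperProfile (((h + 1 : ℕ) : ℝ) / m)
        else upperProfile (((i + 1 : ℕ) : ℝ) / m)) 0) ^ 2 := by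
      refine Finset.sum_le_sum fun h _ => pow_le_pow_left₀ (by linarith) ?_ 2
      refine le_trans ?_ (le_max_left _ _)
      have h2 : ((h + 1 : ℕ) : ℝ) / m ≤ 1 :=
        (div_le_one hm').2 (by exact_mod_cast (h.2 : (h : ℕ) + 1 ≤ m))
      have h3 := upperProfile_le_one h2
      split_ifs <;> linarith
    rw [Finset.sum_const, Finset.card_univ, Fintype.card_fin, nsmul_eq_mul] at h1
    refine le_trans ?_ (mul_le_mul_of_nonneg_left h1 (by norm_num))
    have h2 : (y - 1.367 * upperProfile (((i + 1 : ℕ) : ℝ) / m)) ^ 2 ≤ y ^ 2 :=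
      pow_le_pow_left₀ (by linarith) (by linarith) 2
    have h3 : y ^ 2 ≤ 1.367 * (y - 2) ^ 2 := by nlinarith
    have h4 := mul_le_mul_of_nonneg_left (h2.trans h3) hm'.le
    linarith
  rcases le_total (1 + upperProfile (((i + 1 : ℕ) : ℝ) / m - 367 / 1367)) y with hb | hb
  · exact upper_dual_of_ge hm i (by linarith) hb hy14 (by linarith)
  · have hb1 := upperProfile_le_one (x := ((i + 1 : ℕ) : ℝ) / m - 367 / 1367) (by linarith)
    refine dual_at_of_le (by norm_num) hy hb ?_
      (upper_dual_of_ge hm i (by linarith) le_rfl (by linarith) (by linarith))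
    set x : ℝ := ((i + 1 : ℕ) : ℝ) / m
    -- the machines available before the threshold are idle or started one of the first jobs
    have h1 : (Finset.univ.filter fun h : Fin m =>
        (if h ≤ i then 1 + upperProfile (((h + 1 : ℕ) : ℝ) / m) else upperProfile x) <
          1 + upperProfile (x - 367 / 1367)) ⊆ Finset.Ioi i ∪
        Finset.univ.filter fun h : Fin m => (h : ℕ) < ⌊m * (x - 367 / 1367)⌋₊ := by
      intro h hh
      simp only [Finset.mem_filter, Finset.mem_univ, true_and, Finset.mem_union,
        Finset.mem_Ioi] at hh ⊢
      rcases lt_or_ge i h with h' | h'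
      · exact Or.inl h'
      right
      rw [if_pos h'] at hh
      have h2 : ((h + 1 : ℕ) : ℝ) / m < x - 367 / 1367 := by
        by_contra! hcon
        have h3 : ((h + 1 : ℕ) : ℝ) / m ≤ 1 :=
          (div_le_one hm').2 (by exact_mod_cast (h.2 : (h : ℕ) + 1 ≤ m))
        linarith [upperProfile_monotoneOn (Set.mem_Iic.2 (hcon.trans h3)) h3 hcon]
      rw [div_lt_iff₀ hm', mul_comm] at h2
      exact Nat.lt_of_succ_le (Nat.le_floor h2.le)
    have h2 := (Finset.card_le_card h1).trans (Finset.card_union_le _ _)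
    rw [Fin.card_Ioi] at h2
    have h3 : (Finset.univ.filter fun h : Fin m => (h : ℕ) < ⌊m * (x - 367 / 1367)⌋₊).card ≤
        ⌊m * (x - 367 / 1367)⌋₊ := by
      rw [← Finset.card_map Fin.valEmbedding]
      refine (Finset.card_le_card fun k hk => ?_).trans (Finset.card_range _).le
      simp only [Finset.mem_map, Finset.mem_filter, Finset.mem_univ, true_and] at hk
      obtain ⟨h, hh, rfl⟩ := hk
      simpa using hh
    have h4 := Nat.floor_le (mul_nonneg hm'.le (sub_nonneg.2 hx) : 0 ≤ m * (x - 367 / 1367))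
    have h5 : ((m - 1 - i : ℕ) : ℝ) = m - m * x := by
      rw [← hmx, Nat.sub_sub, Nat.cast_sub (by omega)]; push_cast; ring
    have h6 : ((Finset.univ.filter fun h : Fin m =>
        (if h ≤ i then 1 + upperProfile (((h + 1 : ℕ) : ℝ) / m) else upperProfile x) <
          1 + upperProfile (x - 367 / 1367)).card : ℝ) ≤
        ((m - 1 - i : ℕ) : ℝ) + (⌊m * (x - 367 / 1367)⌋₊ : ℝ) := by
      exact_mod_cast h2.trans (Nat.add_le_add_left h3 _)
    rw [h5] at h6
    have h7 := mul_le_mul_of_nonneg_left (h6.trans (add_le_add_right h4 _))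
      (by norm_num : (0 : ℝ) ≤ 1.367)
    linarith

lemma upper_dualFeasible {m : ℕ} (hm : 1000000 ≤ m) :
    DualFeasible (fun i : Fin m => upperProfile (((i + 1 : ℕ) : ℝ) / m)) 1.367 := by
  have hm0 : 0 < m := by omega
  have hm' : (0 : ℝ) < m := by exact_mod_cast hm0
  have hmR : (1000000 : ℝ) ≤ m := by exact_mod_cast hm
  have hx : ∀ i : Fin m, ((i + 1 : ℕ) : ℝ) / m ≤ 1 := fun i =>
    (div_le_one hm').2 (by exact_mod_cast (i.2 : (i : ℕ) + 1 ≤ m))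
  refine ⟨fun i => upperProfile_nonneg (hx i), fun i j hij =>
    upperProfile_monotoneOn (hx i) (hx j) ?_, ?_, fun i => ?_⟩
  · gcongr; exact hij
  · rw [Fin.sum_univ_eq_sum_range (fun k => upperProfile (((k + 1 : ℕ) : ℝ) / m)), sum_shift_eq,
      upperProfile_zero, div_self hm'.ne']
    have h1 := (riemann_sum_bounds (upperProfile_monotoneOn.mono fun y hy => hy.2) hm0 le_rfl).1
    have hI : ∫ y in (0 : ℝ)..1, upperProfile y = _ := integral_profile (by norm_num) (by norm_num)
    rw [div_self hm'.ne', hI, cubicInt] at h1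
    have h2 := upperProfile_le_one le_rfl
    norm_num at h1 ⊢
    linarith
  · refine (upper_dual hm i).mono (by norm_num) fun h => ?_
    unfold availability
    split_ifs
    · refine max_le (by linarith) ?_
      linarith [upperProfile_le_one (hx i), upperProfile_nonneg (hx h)]
    · exact le_rfl

/-! ### Every online algorithm -/

/-- The completion times of the small jobs in the schedule of the algorithm, when the key pattern
is submitted after the start of the `i`-th long job. Up to a permutation, the machines become
available as in `availability`, because the unfinished long jobs occupy different machines. -/
lemma OnlineAlgorithm.sum_small_le {m : ℕ} (hm : 0 < m) (A : OnlineAlgorithm m)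
    (σ : Equiv.Perm (Fin m)) {t : Fin m → ℝ}
    (ht : ∀ h, t h = (A.schedule (longJobs hm)).start (σ h)) (hmono : Monotone t) (i : Fin m)
    (k : ℕ) {ε r : ℝ} (hε : 0 < ε) (hr : 0 ≤ r) (hir : t i < r) (C : ℝ) :
    ∑ q : Fin (k * m), ε * (C - (A.schedule (keyPattern hm k hε hr)).completion (Fin.natAdd m q)) ≤
      (∑ h, (max (C - availability t i h) 0) ^ 2) / 2 := by
  set S₀ := A.schedule (longJobs hm)
  set S := A.schedule (keyPattern hm k hε hr)
  have hS₀ : S₀.Feasible := A.feasible _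
  have hS : S.Feasible := A.feasible _
  -- the unfinished long jobs
  set U : Finset (Fin m) := Finset.univ.filter fun h => h ≤ i ∧ t i < t h + 1
  have hinj : Set.InjOn (fun h => S₀.machine (σ h)) U := by
    intro h hh h' hh' heq
    simp only [U, Finset.coe_filter, Finset.mem_univ, true_and] at hh hh'
    by_contra hne
    have hne' : σ h ≠ σ h' := fun e => hne (σ.injective e)
    have h1 := hmono hh.1
    have h2 := hmono hh'.1
    have c1 : S₀.completion (σ h) = t h + 1 := by rw [ht]; rfl
    have c2 : S₀.completion (σ h') = t h' + 1 := by rw [ht]; rfl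
    rcases hS₀.2 _ _ hne' heq with h3 | h3
    · rw [c1, ← ht] at h3; linarith [hh.2]
    · rw [c2, ← ht] at h3; linarith [hh'.2]
  obtain ⟨g, hg⟩ := Finset.exists_equiv_extend_of_card_eq (t := (Finset.univ : Finset (Fin m)))
    (by simp) (Finset.subset_univ _) hinj
  set π : Fin m ≃ Fin m := g.trans (Equiv.subtypeUnivEquiv Finset.mem_univ)
  have hπ : ∀ h ∈ U, π h = S₀.machine (σ h) := hg
  have hcausal : ∀ h ≤ i, S.start (Fin.castAdd (k * m) (σ h)) = t h ∧
      S.machine (Fin.castAdd (k * m) (σ h)) = S₀.machine (σ h) := by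
    intro h hh
    have h1 := A.causal (longJobs hm) (keyPattern hm k hε hr) (t i)
      (revealed_longJobs_eq hm k hε hr hir) (σ h) (Fin.castAdd (k * m) (σ h)) rfl
      (by rw [← ht]; exact hmono hh)
    rw [ht]; exact h1
  have hstart : ∀ q : Fin (k * m), r ≤ S.start (Fin.natAdd m q) := by
    intro q
    have h1 := hS.1 (Fin.natAdd m q)
    have h2 : (keyPattern hm k hε hr).r (Fin.natAdd m q) = r := if_neg (by simp)
    rwa [h2] at h1
  have hp : ∀ q : Fin (k * m), S.completion (Fin.natAdd m q) = S.start (Fin.natAdd m q) + ε := by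
    intro q
    have h2 : (keyPattern hm k hε hr).p (Fin.natAdd m q) = ε := if_neg (by simp)
    have h3 : S.completion (Fin.natAdd m q) = S.start (Fin.natAdd m q) +
      (keyPattern hm k hε hr).p (Fin.natAdd m q) := rfl
    rw [h3, h2]
  have hav : ∀ h, ∀ q : Fin (k * m), S.machine (Fin.natAdd m q) = π h →
      availability t i h ≤ S.start (Fin.natAdd m q) := by
    intro h q hq
    have h1 := hstart q
    by_cases hU : h ∈ U
    · rw [hπ h hU] at hq
      simp only [U, Finset.mem_filter, Finset.mem_univ, true_and] at hU
      obtain ⟨c1, c2⟩ := hcausal h hU.1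
      have hne : (Fin.castAdd (k * m) (σ h) : Fin (m + k * m)) ≠ Fin.natAdd m q := by
        intro e
        have := congrArg Fin.val e
        have h2 := (σ h).2
        simp at this
        omega
      have hlong : S.completion (Fin.castAdd (k * m) (σ h)) = t h + 1 := by
        have h2 : (keyPattern hm k hε hr).p (Fin.castAdd (k * m) (σ h)) = 1 := if_pos (σ h).2
        have h3 : S.completion (Fin.castAdd (k * m) (σ h)) = S.start (Fin.castAdd (k * m) (σ h)) +
          (keyPattern hm k hε hr).p (Fin.castAdd (k * m) (σ h)) := rfl
        rw [h3, h2, c1]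
      rw [availability, if_pos hU.1, max_eq_left hU.2.le]
      rcases hS.2 _ _ hne (c2.trans hq.symm) with h3 | h3
      · rwa [hlong] at h3
      · rw [hp, c1] at h3
        linarith [hmono hU.1]
    · have h2 : availability t i h = t i := by
        unfold availability
        split_ifs with h3
        · refine max_eq_right (not_lt.1 fun h4 => hU ?_)
          simp only [U, Finset.mem_filter, Finset.mem_univ, true_and]
          exact ⟨h3, h4⟩
        · rfl
      linarith
  simp only [hp]
  rw [← Finset.sum_fiberwise Finset.univ (fun q => S.machine (Fin.natAdd m q)),
    ← Equiv.sum_comp π, Finset.sum_div]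
  refine Finset.sum_le_sum fun h _ => sum_machine_le _ (fun q => S.start (Fin.natAdd m q)) hε
    (fun q hq => hav h q (Finset.mem_filter.1 hq).2) fun q hq q' hq' hne => ?_
  have h1 := hS.2 (Fin.natAdd m q) (Fin.natAdd m q')
    (fun e => hne (Fin.natAdd_injective _ _ e))
    ((Finset.mem_filter.1 hq).2.trans (Finset.mem_filter.1 hq').2.symm)
  rwa [hp, hp] at h1

/-- The delays with which an algorithm starts the long jobs respect its competitive ratio. -/
lemma OnlineAlgorithm.targetRatio_le {m : ℕ} (hm : 0 < m) (A : OnlineAlgorithm m) {R : ℝ}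
    (hA : A.competitiveRatio ≤ (R : EReal)) : targetRatio m ≤ R := by
  have hm' : (0 : ℝ) < m := by exact_mod_cast hm
  set s : Fin m → ℝ := (A.schedule (longJobs hm)).start
  set σ := Tuple.sort s
  set t : Fin m → ℝ := fun h => s (σ h) with htdef
  have hmono : Monotone t := Tuple.monotone_sort s
  have hnn : ∀ h, 0 ≤ t h := fun h => (A.feasible (longJobs hm)).1 (σ h)
  refine OnlineScheduling.targetRatio_le hm
    ((dualFeasible_iff hm t R).2 ⟨hnn, hmono, ?_, fun i C hC => ?_⟩)
  · have h1 := A.cost_le hA (longJobsSchedule_feasible hm)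
    rw [longJobsSchedule_cost] at h1
    have h2 : (A.schedule (longJobs hm)).cost = m + ∑ i, t i := by
      have h3 : (A.schedule (longJobs hm)).cost = ∑ j : Fin m, (s j + 1) := rfl
      rw [h3, Finset.sum_add_distrib, add_comm, ← Equiv.sum_comp σ s]
      simp [htdef]
    rwa [div_le_iff₀ hm', ← h2]
  · have hV := sum_max_sub_pos hC
    rw [keyRatio_le_iff hm (hnn i) hC, sum_max_sq_sub_sq]
    set V := ∑ h, (max (availability t i h) C - availability t i h)
    have e1 : ∑ h, (max (C - availability t i h) 0) ^ 2 =
        ∑ h, (max (availability t i h) C - availability t i h) ^ 2 :=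
      Finset.sum_congr rfl fun h _ => by rw [← max_sub_sub_right, sub_self, max_comm]
    set Q := ∑ h, (max (availability t i h) C - availability t i h) ^ 2
    -- the bound for `(k + 1) * m` small jobs of total processing time `V`, submitted at time
    -- `t i + e` for `e = 1 / (k + 1)`
    have key : ∀ k : ℕ, V * C - Q / 2 ≤ (fun e : ℝ => R * (V * e * (t i + e + V / m + 1) +
        V * (t i + e) + V ^ 2 / (2 * m) * (1 + e))) (1 / ((k : ℝ) + 1)) := by
      intro k
      have hk : (0 : ℝ) < (k : ℝ) + 1 := by positivity
      have he : (0 : ℝ) < 1 / ((k : ℝ) + 1) := by positivity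
      obtain ⟨ε, hεdef⟩ : ∃ ε, ε = V / (((k + 1 : ℕ) : ℝ) * m) := ⟨_, rfl⟩
      have hε : 0 < ε := by rw [hεdef]; positivity
      have hr : 0 ≤ t i + 1 / ((k : ℝ) + 1) := add_nonneg (hnn i) he.le
      have h1 := A.sum_small_le hm σ (t := t) (fun _ => rfl) hmono i (k + 1) hε hr
        (lt_add_of_pos_right _ he) C
      have h2 := A.cost_le hA (keyPatternSchedule_feasible hm (k + 1) hε hr)
      rw [keyPatternSchedule_cost] at h2
      set S := A.schedule (keyPattern hm (k + 1) hε hr)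
      have h3 : ∑ q : Fin ((k + 1) * m), S.completion (Fin.natAdd m q) ≤ S.cost := by
        have h4 : S.cost = _ :=
          Fin.sum_univ_add (fun j : Fin (m + (k + 1) * m) => S.completion j)
        rw [h4]
        refine le_add_of_nonneg_left (Finset.sum_nonneg fun j _ => ?_)
        have h5 := (A.feasible (keyPattern hm (k + 1) hε hr)).1 (Fin.castAdd _ j)
        have h6 := (keyPattern hm (k + 1) hε hr).r_nonneg (Fin.castAdd _ j)
        have h7 := (keyPattern hm (k + 1) hε hr).p_pos (Fin.castAdd _ j)
        have h8 : S.completion (Fin.castAdd _ j) = S.start (Fin.castAdd _ j) +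
          (keyPattern hm (k + 1) hε hr).p (Fin.castAdd _ j) := rfl
        rw [h8]
        linarith
      rw [e1, ← Finset.mul_sum, Finset.sum_sub_distrib, Finset.sum_const, Finset.card_univ,
        Fintype.card_fin, nsmul_eq_mul] at h1
      have h4 := mul_le_mul_of_nonneg_left (h3.trans h2) hε.le
      have h5 : ε * ((((k + 1) * m : ℕ) : ℝ) * C) = V * C := by
        rw [hεdef]; push_cast; field_simp
      have h6 : ε * (R * (m * (t i + 1 / ((k : ℝ) + 1) + ((k + 1 : ℕ) : ℝ) * ε + 1) +
          m * (((k + 1 : ℕ) : ℝ) * (t i + 1 / ((k : ℝ) + 1)) +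
            ε * (((k + 1 : ℕ) : ℝ) * (((k + 1 : ℕ) : ℝ) + 1) / 2)))) =
          R * (V * (1 / ((k : ℝ) + 1)) * (t i + 1 / ((k : ℝ) + 1) + V / m + 1) +
            V * (t i + 1 / ((k : ℝ) + 1)) + V ^ 2 / (2 * m) * (1 + 1 / ((k : ℝ) + 1))) := by
        rw [hεdef]; push_cast; field_simp; ring
      rw [mul_sub, h5] at h1
      simp only
      linarith
    have hlim := ((by fun_prop : Continuous fun e : ℝ => R * (V * e * (t i + e + V / m + 1) +
        V * (t i + e) + V ^ 2 / (2 * m) * (1 + e))).tendsto 0).comp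
      (tendsto_one_div_add_atTop_nhds_zero_nat (𝕜 := ℝ))
    have h1 := ge_of_tendsto' hlim key
    have h2 : R * (2 * t i * V + V ^ 2 / m) = 2 * (R * (V * 0 * (t i + 0 + V / m + 1) +
        V * (t i + 0) + V ^ 2 / (2 * m) * (1 + 0))) := by
      field_simp; ring
    rw [h2]
    linarith

lemma OnlineAlgorithm.targetRatio_le_competitiveRatio {m : ℕ} (hm : 0 < m)
    (A : OnlineAlgorithm m) : ((targetRatio m : ℝ) : EReal) ≤ A.competitiveRatio := by
  have hbot : A.competitiveRatio ≠ ⊥ := fun h => by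
    have h1 := le_iSup (fun I : Instance => (((A.schedule I).cost / I.opt m : ℝ) : EReal))
      (longJobs hm)
    rw [show (⨆ I : Instance, (((A.schedule I).cost / I.opt m : ℝ) : EReal)) = ⊥ from h] at h1
    exact EReal.coe_ne_bot _ (le_bot_iff.1 h1)
  by_cases htop : A.competitiveRatio = ⊤
  · rw [htop]; exact le_top
  · have h1 := EReal.coe_toReal htop hbot
    rw [← h1]
    exact EReal.coe_le_coe_iff.2 (A.targetRatio_le hm h1.ge)

end OnlineScheduling

theorem mainTheorem1 :
    (∀ m : ℕ, 0 < m → ∀ A : OnlineAlgorithm m,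
      ((targetRatio m : ℝ) : EReal) ≤ A.competitiveRatio) ∧
    |targetRatio 2 - 1.54610| ≤ 0.000005 ∧
    (∀ m : ℕ, 0 < m → targetRatio (2 * m) < targetRatio m) ∧
    (∃ L : ℝ, Tendsto targetRatio atTop (𝓝 L) ∧ |L - 1.366| < 0.001 ∧
      ∀ m : ℕ, 0 < m → L < targetRatio m) ∧
    1.520 < targetRatio 2 ∧
    (∀ m : ℕ, 0 < m → 1.309 < targetRatio m) := by
  obtain ⟨L, hL, hlt⟩ := exists_tendsto_targetRatio
  have hlow : 1.3651 ≤ L := by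
    refine ge_of_tendsto hL ?_
    filter_upwards [eventually_ge_atTop 1000000] with m hm
    obtain ⟨t, H⟩ := exists_dualFeasible_targetRatio (show 0 < m by omega)
    exact (lower_lt_of_dualFeasible hm H).le
  have hup : L < 1.367 :=
    (hlt 1000000 (by norm_num)).trans_le
      (targetRatio_le (by norm_num) (upper_dualFeasible le_rfl))
  have h2 := targetRatio_two_gt
  have h2' := targetRatio_two_le
  refine ⟨fun m hm A => A.targetRatio_le_competitiveRatio hm, ?_,
    fun m hm => targetRatio_two_mul_lt hm, ⟨L, hL, ?_, hlt⟩, by linarith, fun m hm => ?_⟩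
  · rw [abs_le]; constructor <;> linarith
  · rw [abs_lt]; constructor <;> linarith
  · linarith [hlt m hm]
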